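/- Let $G$ be a compact (Hausdorff) Abelian group with Haar probability measure $\mu_G$ and dual group $\widehat G$ (the continuous homomorphisms $G\to S^1$). For $f\in L^1(G)$ write $\widehat f(\gamma)=\int f\overline{\gamma}\,d\mu_G$, let $A(G)=\{f\in L^1(G):\sum_{\gamma}|\widehat f(\gamma)|<\infty\}$ and $\|f\|_{A(G)}=\sum_{\gamma}|\widehat f(\gamma)|$. For $z\in S^1$ let $\|z\|=\frac1{2\pi}\inf_{n\in\mathbb Z}|2\pi n+\arg z|$, and for a set $\Gamma\subset\widehat G$ and $\delta\in\mathbb R$ let $B(\Gamma,\delta)=\{x\in G:\|\gamma(x)\|\le\delta\text{ for all }\gamma\in\Gamma\}$. Fix constants $c_{\mathcal R},C_{\mathcal R}>0$. For $\Gamma$ finite and non-empty, $d=|\Gamma|$ and $\delta\in(0,1]$, the Bohr set $B(\Gamma,\delta)$ is called regular if $$\left|\frac{\mu_G(B(\Gamma,(1+\kappa)\delta))}{\mu_G(B(\Gamma,\delta))}-1\right|\le C_{\mathcal R}|\kappa|d\quad\text{whenever }\kappa\in\mathbb R,\ |\kappa|d\le c_{\mathcal R}.$$ Let $\beta$ be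 the measure induced by $\mu_G$ on $B(\Gamma,\delta)$, normalised to be a probability measure, let $\|f\|_{L^\infty(B(\Gamma,\delta))}$ be the essential supremum of $|f|$ with respect to $\beta$, and let $\widehat{f\,d\beta}(\gamma)=\int f\overline\gamma\,d\beta$. **Proposition 6.4.** There are constants $C,c>0$, depending only on $c_{\mathcal R}$ and $C_{\mathcal R}$, with the following property. Suppose that $G$ is a compact Abelian group, $\Gamma\subset\widehat G$ is finite and non-empty with $|\Gamma|=d$, $\delta\in(0,1]$, and $B(\Gamma,\delta)$ is regular. Suppose that $f\in A(G)$ has $\|f\|_{L^\infty(B(\Gamma,\delta))}\neq0$ and that $\epsilon,\eta\in(0,1]$. Write $A_f=\|f\|_{A(G)}\,\|f\|_{L^\infty(B(\Gamma,\delta))}^{-1}$. Then there are a finite set $\Lambda\subset\widehat G$ and a $\delta'\in(0,1]$ with $$|\Lambda|\le C\epsilon^{-1}(1+\log A_f),\qquad \delta'\ge \frac{c\,\epsilon^2\eta\delta}{d^2(1+\log A_f)},$$ such that $$\{\gamma\in\widehat G:|\widehat{f\,d\beta}(\gamma)|\ge\epsilon\|f\|_{L^\infty(B(\Gamma,\delta))}\}\subset\{\gamma\in\widehat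 G:|1-\gamma(x)|\le\eta\text{ for all }x\in B(\Gamma\cup\Lambda,\delta')\}.$$ -/

import Mathlib

open MeasureTheory MeasureTheory.Measure

namespace LocalChang

noncomputable section

/-- The valuation `‖z‖ = (1 / 2π) inf_{n ∈ ℤ} |2πn + arg z|` on the unit circle. -/
def circleVal (z : Circle) : ℝ :=
  (1 / (2 * Real.pi)) * ⨅ n : ℤ, |2 * Real.pi * (n : ℝ) + Complex.arg (z : ℂ)|

/-- Since Mathlib's argument lies in `(-π, π]`, the infimum is attained at `n = 0`. -/
theorem circleVal_eq (z : Circle) :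
    circleVal z = |Complex.arg (z : ℂ)| / (2 * Real.pi) := by
  have hpi := Real.pi_pos
  have h : (⨅ n : ℤ, |2 * Real.pi * (n : ℝ) + Complex.arg (z : ℂ)|)
      = |Complex.arg (z : ℂ)| := by
    apply le_antisymm
    · have hb : BddBelow (Set.range fun n : ℤ =>
          |2 * Real.pi * (n : ℝ) + Complex.arg (z : ℂ)|) :=
        ⟨0, by rintro _ ⟨n, rfl⟩; exact abs_nonneg _⟩
      simpa using ciInf_le hb 0
    · refine le_ciInf fun n => ?_
      have h1 := Complex.abs_arg_le_pi (z : ℂ)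
      rcases eq_or_ne n 0 with rfl | hn
      · simp
      · have h2 : (1 : ℝ) ≤ |(n : ℝ)| := by
          exact_mod_cast Int.one_le_abs hn
        have h3 : |2 * Real.pi * (n : ℝ)| = 2 * Real.pi * |(n : ℝ)| := by
          rw [abs_mul, abs_of_pos (by positivity)]
        have h4 := abs_sub_abs_le_abs_sub (2 * Real.pi * (n : ℝ)) (-Complex.arg (z : ℂ))
        rw [abs_neg, sub_neg_eq_add, h3] at h4
        nlinarith
  rw [circleVal, h]
  ring

section Groups

variable {G : Type*} [CommGroup G] [TopologicalSpace G]

/-- The Bohr set `B(Γ, δ) = {x : ‖γ(x)‖ ≤ δ for all γ ∈ Γ}`. -/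
def bohrSet (Γ : Set (PontryaginDual G)) (δ : ℝ) : Set G :=
  {x | ∀ γ ∈ Γ, circleVal (γ x) ≤ δ}

variable [MeasurableSpace G]

/-- `B(Γ, δ)` is regular, with threshold `cR` and implied constant `CR`: with `d = |Γ|`,
`μ(B(Γ, (1 + κ)δ)) / μ(B(Γ, δ)) = 1 + O(|κ| d)` whenever `|κ| d ≤ cR`. -/
def IsRegularBohr (cR CR : ℝ) (μ : Measure G) (Γ : Finset (PontryaginDual G)) (δ : ℝ) : Prop :=
  ∀ κ : ℝ, |κ| * (Γ.card : ℝ) ≤ cR →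
    |μ.real (bohrSet (Γ : Set (PontryaginDual G)) ((1 + κ) * δ)) /
        μ.real (bohrSet (Γ : Set (PontryaginDual G)) δ) - 1| ≤ CR * (|κ| * (Γ.card : ℝ))

/-- The normalised Bohr cutoff `β`: the probability measure induced by `μ` on `B(Γ, δ)`. -/
def bohrCutoff (μ : Measure G) (Γ : Set (PontryaginDual G)) (δ : ℝ) : Measure G :=
  ProbabilityTheory.cond μ (bohrSet Γ δ)

/-- The Fourier transform `γ ↦ ∫ f(x) conj(γ(x)) dν(x)` of the measure `f dν`. -/
def fourier (ν : Measure G) (f : G → ℂ) (γ : PontryaginDual G) : ℂ :=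
  ∫ x, f x * (starRingEnd ℂ) (γ x : ℂ) ∂ν

/-- `f ∈ A(G)`: `f` is integrable and its Fourier transform is absolutely summable. -/
def MemA (μ : Measure G) (f : G → ℂ) : Prop :=
  Integrable f μ ∧ Summable fun γ : PontryaginDual G => ‖fourier μ f γ‖

/-- The norm of `A(G)`: the `ℓ¹` norm of the Fourier transform. -/
def normA (μ : Measure G) (f : G → ℂ) : ℝ :=
  ∑' γ : PontryaginDual G, ‖fourier μ f γ‖

/-- The norm of `L^∞(B(Γ, δ))`: the essential supremum of `|f|` with respect to the cutoff.
It is finite for every `f ∈ A(G)`. -/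
def supNormBohr (μ : Measure G) (Γ : Set (PontryaginDual G)) (δ : ℝ) (f : G → ℂ) : ℝ :=
  (eLpNorm f ⊤ (bohrCutoff μ Γ δ)).toReal

end Groups

end

end LocalChang

namespace LocalChang

noncomputable section

set_option linter.unusedSectionVars false

/-! ### Characters of a group from commuting unitary representations. -/

section Gelfand

open WeakDual Set

variable {G : Type*} [CommGroup G] [TopologicalSpace G]
variable {A : Type*} [CStarAlgebra A]

/-! The proof is a local form of Chang's theorem, by Riesz products. Write `B` for the Bohr set, `M`
for its measure, `S` for the supremum norm of `f` on `B`, and `A = normA / S`.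

Smoothing. Regularity lets the indicator of `B` be replaced by `u`, an `n`-fold convolution of a
symmetric density `k` with a cutoff, at a cost of `ε/2` in the normalised coefficients
(`exists_smooth_cutoff`, `norm_fourier_bohrCutoff_le`). Then `|û| ≤ M |k̂|^n`. Put `T = {|k̂| >
1/2}`. The kernel is cut at a slowly growing radius, so a small Bohr set on `Γ` alone makes every
character of `T` nearly trivial (`exists_kernel`).

Riesz products. Let `Λ` be dissociated modulo `T`, and let `K` be the `n`-th convolution power of
`k`, with `n` even, so that `K̂ = |k̂|^n ≥ 0`. At nonzero words of `Λ`, `K̂` is at most `2^{-n}`.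
Hence `K ∏(1 + Re λ)` has mean at most 2 and, being nonnegative, has all coefficients at most 2. By
domination `u ∏(1 + z Re(ω_λ λ))` has coefficients at most `2M` for every complex `|z| ≤ 1`
(`norm_integral_rieszProd_le`). Its integral against `f` is a polynomial `Q(z)`, at most `2MS` on
`[-1, 1]`, where the product is nonnegative, and at most `2MSA` on the disc, by duality with the
`A(G)` norm.

Logarithm. The three lines theorem, after mapping a strip onto the disc, gives `|Q'(0)| ≪ MS(1 + log
A)` (`norm_deriv_zero_le`). As `Q'(0)` is the linear term, suitable phases bound the `ℓ¹` sum of the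
coefficients of `f u` over `Λ`. Each is at least `εSM/2` on the large spectrum, so `|Λ| ≪ ε⁻¹(1 +
log A)`.

Conclusion. A maximal such `Λ` puts every large frequency in `T` up to a word in `Λ`
(`exists_isDissociated_span`). The two factors are controlled by the conditions on `Γ` and on `Λ`
respectively.

The duality step needs Fourier inversion on `A(G)`. This rests on characters separating points,
which is proved from Gelfand theory applied to translations on `L²`. -/

theorem exists_character_of_commuting_rep (B : StarSubalgebra ℂ A) (hB : IsClosed (B : Set A))
    (hcomm : ∀ x ∈ B, ∀ y ∈ B, x * y = y * x)
    (π : G →* A) (hstar : ∀ x, star (π x) = π x⁻¹) (hπ : ∀ x, π x ∈ B)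
    {T : A} (hT : T ∈ B) (hc : Continuous fun x => π x * T) {a : G}
    (ha : (π a - 1) * T ≠ 0) : ∃ χ : PontryaginDual G, χ a ≠ 1 := by
  have : IsClosed (B : Set A) := hB
  let _ : CommCStarAlgebra B :=
    { StarSubalgebra.cstarAlgebra B with mul_comm := fun x y => Subtype.ext (hcomm _ x.2 _ y.2) }
  let t : B := ⟨T, hT⟩
  let p : G → B := fun x => ⟨π x, hπ x⟩
  have hp1 : p 1 = 1 := Subtype.ext (map_one π)
  have hpm : ∀ x y, p (x * y) = p x * p y := fun x y => Subtype.ext (map_mul π x y)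
  have hps : ∀ x, star (p x) = p x⁻¹ := fun x => Subtype.ext (hstar x)
  have hne : (p a - 1) * t ≠ 0 := fun h => ha (congrArg Subtype.val h)
  -- The Gelfand transform of a commutative C*-algebra is injective, so some algebra character
  -- detects this nonzero element.
  obtain ⟨φ, hφ⟩ : ∃ φ : characterSpace ℂ B, φ ((p a - 1) * t) ≠ 0 := by
    by_contra! h
    apply hne
    apply (gelfandTransform_isometry B).injective
    ext φ
    simpa using h φ
  rw [map_mul, map_sub, map_one] at hφ
  have ht : φ t ≠ 0 := right_ne_zero_of_mul hφ
  have hu : ∀ x, ‖φ (p x)‖ = 1 := by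
    intro x
    have h1 : φ (star (p x) * p x) = 1 := by
      rw [hps, ← hpm, inv_mul_cancel, hp1, map_one]
    rw [map_mul, map_star] at h1
    have h2 := congrArg norm h1
    rw [norm_mul, norm_star, norm_one] at h2
    nlinarith [norm_nonneg (φ (p x))]
  -- Only `x ↦ π x * T` is norm continuous; dividing by `φ t ≠ 0` recovers continuity of `φ ∘ π`.
  have hcont : Continuous fun x => φ (p x) := by
    have h1 : (fun x => φ (p x)) = fun x => φ (p x * t) / φ t := by
      funext x
      rw [map_mul, mul_div_cancel_right₀ _ ht]
    rw [h1]
    exact ((map_continuous φ).comp (Continuous.subtype_mk hc _)).div_const _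
  let χ : G →ₜ* Circle :=
    { toFun := fun x => ⟨φ (p x), mem_sphere_zero_iff_norm.2 (hu x)⟩
      map_one' := by ext; simp [hp1]
      map_mul' := fun x y => by ext; simp only [hpm, map_mul]; rfl
      continuous_toFun := Continuous.subtype_mk hcont _ }
  refine ⟨χ, fun h => ?_⟩
  have h1 : φ (p a) = 1 := congrArg Subtype.val h
  exact hφ (by rw [h1, sub_self, zero_mul])

/-- The bicommutant of a commutative unitary representation is commutative. -/
theorem exists_character_of_bicommutant
    (π : G →* A) (hstar : ∀ x, star (π x) = π x⁻¹)
    {T : A} (hT : ∀ S : A, (∀ x, π x * S = S * π x) → S * T = T * S)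
    (hc : Continuous fun x => π x * T) {a : G}
    (ha : (π a - 1) * T ≠ 0) : ∃ χ : PontryaginDual G, χ a ≠ 1 := by
  let C : StarSubalgebra ℂ A := StarSubalgebra.centralizer ℂ (range π)
  let B : StarSubalgebra ℂ A := StarSubalgebra.centralizer ℂ (C : Set A)
  have hCmem : ∀ S, S ∈ C ↔ ∀ x, π x * S = S * π x := by
    intro S
    simp only [C, StarSubalgebra.mem_centralizer_iff, forall_mem_range]
    exact ⟨fun h x => (h x).1, fun h x => ⟨h x, by rw [hstar]; exact h _⟩⟩
  have hBmem : ∀ S, S ∈ B ↔ ∀ R ∈ C, R * S = S * R := by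
    intro S
    simp only [B, StarSubalgebra.mem_centralizer_iff, SetLike.mem_coe]
    exact ⟨fun h R hR => (h R hR).1, fun h R hR => ⟨h R hR, h _ (star_mem hR)⟩⟩
  have hπC : ∀ x, π x ∈ C := fun x => (hCmem _).2 fun y => by
    rw [← map_mul, mul_comm, map_mul]
  -- The range of `π` commutes with itself, so the bicommutant `B` lies in the commutant `C`. Since
  -- `B` commutes with `C`, it is commutative.
  have hBC : ∀ S ∈ B, S ∈ C := fun S hS => (hCmem _).2 fun x => (hBmem S).1 hS _ (hπC x)
  refine exists_character_of_commuting_rep B ?_ (fun x hx y hy => (hBmem y).1 hy x (hBC x hx))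
    π hstar (fun x => (hBmem _).2 fun R hR => ((hCmem R).1 hR x).symm)
    ((hBmem T).2 fun R hR => hT R ((hCmem R).1 hR)) hc ha
  rw [StarSubalgebra.coe_centralizer]
  exact Set.isClosed_centralizer _

end Gelfand

/-! ### Translations on `L²` and separation of points by characters. -/

section Separation

open DomMulAct Set

variable {G : Type*} [CommGroup G] [TopologicalSpace G] [IsTopologicalGroup G]
  [CompactSpace G] [T2Space G] [MeasurableSpace G] [BorelSpace G]
  (μ : Measure G) [IsHaarMeasure μ] [IsProbabilityMeasure μ]

theorem isProbabilityMeasure_haarMeasure_top :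
    IsProbabilityMeasure (haarMeasure (⊤ : TopologicalSpace.PositiveCompacts G)) :=
  ⟨by simpa using haarMeasure_self (K₀ := (⊤ : TopologicalSpace.PositiveCompacts G))⟩

/-- Haar probability measures on a compact group coincide, so regularity is inherited from
`haarMeasure`. It supplies strong continuity of translation, `L¹` density of continuous functions
and inversion invariance. -/
theorem regular_of_isHaarMeasure_of_isProbabilityMeasure : μ.Regular := by
  have h := isProbabilityMeasure_haarMeasure_top (G := G)
  rw [isHaarMeasure_eq_of_isProbabilityMeasure μ
    (haarMeasure (⊤ : TopologicalSpace.PositiveCompacts G))]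
  infer_instance

abbrev L2 := Lp ℂ 2 μ

/-- Translation `f ↦ f(x ·)` on `L²`. -/
def translation : G →* (L2 μ →L[ℂ] L2 μ) where
  toFun x := LinearMap.mkContinuous
    { toFun := fun f => DomMulAct.mk x • f
      map_add' := fun f g => smul_add _ f g
      map_smul' := fun c f => smul_comm _ c f } 1 (fun f => by
        simp)
  map_one' := by
    ext1 f
    change DomMulAct.mk (1 : G) • f = f
    rw [DomMulAct.mk_one, one_smul]
  map_mul' x y := by
    ext1 f
    change DomMulAct.mk (x * y) • f = DomMulAct.mk x • DomMulAct.mk y • f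
    rw [smul_smul, mul_comm x y]
    rfl

theorem translation_apply (x : G) (f : L2 μ) : translation μ x f = DomMulAct.mk x • f := rfl

theorem norm_translation (x : G) (f : L2 μ) : ‖translation μ x f‖ = ‖f‖ := by
  rw [translation_apply, norm_smul_Lp]

theorem star_translation (x : G) : star (translation μ x) = translation μ x⁻¹ := by
  have hinner : ∀ (y : G) (f g : L2 μ),
      inner ℂ (translation μ y f) (translation μ y g) = inner ℂ f g := by
    intro y f g
    let U : L2 μ →ₗᵢ[ℂ] L2 μ := ⟨(translation μ y).toLinearMap, norm_translation μ y⟩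
    exact U.inner_map_map f g
  rw [ContinuousLinearMap.star_eq_adjoint]
  symm
  rw [ContinuousLinearMap.eq_adjoint_iff]
  intro f g
  rw [← hinner x, ← mul_apply_eq_comp, ← map_mul, mul_inv_cancel, map_one]
  rfl

theorem continuous_translation (f : L2 μ) : Continuous fun x => translation μ x f := by
  have := regular_of_isHaarMeasure_of_isProbabilityMeasure μ
  have : Fact ((2 : ENNReal) ≠ ⊤) := ⟨by simp⟩
  have h : Continuous fun x : G => DomMulAct.mk x • f :=
    (continuous_mk.smul continuous_const)
  exact h

theorem Continuous.integrable_of_compactSpace {E : Type*} [NormedAddCommGroup E] {f : G → E}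
    (hf : Continuous f) : Integrable f μ :=
  hf.integrable_of_hasCompactSupport (HasCompactSupport.of_compactSpace f)

/-- The average `∫ k(y) U_y dμ(y)` of the translation operators. -/
def averaging : C(G, ℂ) →L[ℂ] L2 μ →L[ℂ] L2 μ :=
  have hi : ∀ (k : C(G, ℂ)) (f : L2 μ), Integrable (fun y => k y • translation μ y f) μ :=
    fun k f => Continuous.integrable_of_compactSpace μ
      (k.continuous.smul (continuous_translation μ f))
  LinearMap.mkContinuous₂
    (LinearMap.mk₂ ℂ (fun (k : C(G, ℂ)) (f : L2 μ) => ∫ y, k y • translation μ y f ∂μ)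
      (fun k l f => by
        simp only [ContinuousMap.add_apply, add_smul]
        exact integral_add (hi k f) (hi l f))
      (fun c k f => by
        simp only [ContinuousMap.smul_apply, smul_assoc]
        exact integral_smul c _)
      (fun k f g => by
        simp only [map_add, smul_add]
        exact integral_add (hi k f) (hi k g))
      (fun c k f => by
        simp only [map_smul, smul_comm _ c]
        exact integral_smul c _)) 1 (fun k f => by
      rw [one_mul]
      refine (norm_integral_le_of_norm_le_const (C := ‖k‖ * ‖f‖) (ae_of_all _ fun y => ?_)).trans ?_
      · rw [norm_smul, norm_translation]
        gcongr
        exact k.norm_coe_le_norm y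
      · simp)

theorem averaging_apply (k : C(G, ℂ)) (f : L2 μ) :
    averaging μ k f = ∫ y, k y • translation μ y f ∂μ := rfl

/-- A bounded operator passes through the Bochner integral; this places the averages in the
bicommutant of the translations. -/
theorem commute_averaging (k : C(G, ℂ)) (S : L2 μ →L[ℂ] L2 μ)
    (hS : ∀ x, translation μ x * S = S * translation μ x) :
    S * averaging μ k = averaging μ k * S := by
  ext1 f
  change S (averaging μ k f) = averaging μ k (S f)
  rw [averaging_apply, averaging_apply, ← ContinuousLinearMap.integral_comp_comm]
  · refine integral_congr_ae (ae_of_all _ fun y => ?_)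
    have := congrArg (fun R : L2 μ →L[ℂ] L2 μ => R f) (hS y)
    simp only [map_smul]
    exact congrArg _ this.symm
  · exact Continuous.integrable_of_compactSpace μ
      (k.continuous.smul (continuous_translation μ f))

/-- Translating an average amounts to translating `k`. The translate of `k` varies continuously in
supremum norm and `averaging` is bounded, which upgrades strong continuity to norm continuity. -/
theorem continuous_translation_mul_averaging (k : C(G, ℂ)) :
    Continuous fun x => translation μ x * averaging μ k := by
  let τ : C(G, C(G, ℂ)) := ContinuousMap.curry ⟨fun p : G × G => k (p.1⁻¹ * p.2), by fun_prop⟩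
  have h : (fun x => translation μ x * averaging μ k) = fun x => averaging μ (τ x) := by
    funext x
    ext1 f
    change translation μ x (averaging μ k f) = averaging μ (τ x) f
    rw [averaging_apply, averaging_apply, ← ContinuousLinearMap.integral_comp_comm]
    · rw [← integral_mul_left_eq_self (fun y => τ x y • translation μ y f) x]
      refine integral_congr_ae (ae_of_all _ fun y => ?_)
      simp only [map_smul, τ, ContinuousMap.curry_apply, ContinuousMap.coe_mk,
        inv_mul_cancel_left, map_mul]
      rfl
    · exact Continuous.integrable_of_compactSpace μ
        (k.continuous.smul (continuous_translation μ f))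
  rw [h]
  exact (averaging μ).continuous.comp τ.continuous

/-- An approximate identity does not kill a given nonzero vector. -/
theorem exists_averaging_ne_zero {h : L2 μ} (hh : h ≠ 0) :
    ∃ k : C(G, ℂ), averaging μ k h ≠ 0 := by
  let V : Set G := {y | ‖translation μ y h - h‖ < ‖h‖}
  have hcU := continuous_translation μ h
  have hV : IsOpen V := isOpen_lt ((hcU.sub continuous_const).norm) continuous_const
  have h1V : (1 : G) ∈ V := by
    simp only [V, mem_ofPred_eq, map_one, one_apply_eq_self, sub_self, norm_zero]
    exact norm_pos_iff.2 hh
  obtain ⟨k, hk0, hk1, hk01⟩ := exists_continuous_zero_one_of_isClosed (X := G)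
    (s := Vᶜ) (t := {1}) hV.isClosed_compl isClosed_singleton
    (by rw [disjoint_singleton_right]; exact fun h => h h1V)
  let kc : C(G, ℂ) := ⟨fun x => (k x : ℂ), by fun_prop⟩
  refine ⟨kc, fun h0 => ?_⟩
  have hck : Continuous k := k.continuous
  -- `k` lives where `‖U_y h - h‖ < ‖h‖`. If the average of `h` vanished, the triangle inequality
  -- for `∫ k(y)(U_y h - h)` would contradict this positivity.
  have hpos : 0 < ∫ y, k y * (‖h‖ - ‖translation μ y h - h‖) ∂μ := by
    refine Continuous.integral_pos_of_hasCompactSupport_nonneg_nonzero (x := 1) (by fun_prop)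
      (HasCompactSupport.of_compactSpace _) (fun y => ?_) ?_
    · by_cases hy : y ∈ V
      · exact mul_nonneg (hk01 y).1 (sub_nonneg.2 (le_of_lt hy))
      · simp [hk0 (show y ∈ Vᶜ from hy)]
    · have : k 1 = 1 := hk1 rfl
      simpa [this] using hh
  have e1 : ∫ y, k y * (‖h‖ - ‖translation μ y h - h‖) ∂μ
      = (∫ y, k y ∂μ) * ‖h‖ - ∫ y, ‖kc y • (translation μ y h - h)‖ ∂μ := by
    rw [← integral_mul_const, ← integral_sub]
    · refine integral_congr_ae (ae_of_all _ fun y => ?_)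
      simp only [norm_smul, kc, ContinuousMap.coe_mk, Complex.norm_real,
        Real.norm_of_nonneg (hk01 y).1]
      ring
    · exact Continuous.integrable_of_compactSpace μ (by fun_prop)
    · exact Continuous.integrable_of_compactSpace μ (by fun_prop)
  have e2 : ∫ y, kc y • (translation μ y h - h) ∂μ = - ((∫ y, k y ∂μ : ℝ) : ℂ) • h := by
    simp only [smul_sub]
    rw [integral_sub, ← averaging_apply, h0, zero_sub, integral_smul_const, neg_smul]
    · congr 2
      exact integral_ofReal
    · exact Continuous.integrable_of_compactSpace μ (by fun_prop)
    · exact Continuous.integrable_of_compactSpace μ (by fun_prop)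
  have e3 := norm_integral_le_integral_norm (μ := μ) fun y => kc y • (translation μ y h - h)
  rw [e2, norm_smul, norm_neg, Complex.norm_real, Real.norm_of_nonneg
    (integral_nonneg fun y => (hk01 y).1)] at e3
  linarith

end Separation

/-- The characters of a compact abelian group separate points. -/
theorem exists_character_ne_one {G : Type*} [CommGroup G] [TopologicalSpace G]
    [IsTopologicalGroup G] [CompactSpace G] [T2Space G] {a : G} (ha : a ≠ 1) :
    ∃ χ : PontryaginDual G, χ a ≠ 1 := by
  borelize G
  let μ : Measure G := haarMeasure ⊤
  have : IsProbabilityMeasure μ := isProbabilityMeasure_haarMeasure_top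
  obtain ⟨f₀, hf0, hf1, -⟩ := exists_continuous_zero_one_of_isClosed (X := G)
    (s := {a}) (t := {1}) isClosed_singleton isClosed_singleton (by simpa using ha)
  have hm : MemLp (fun x => (f₀ x : ℂ)) 2 μ :=
    Continuous.memLp_of_hasCompactSupport (by fun_prop) (HasCompactSupport.of_compactSpace _)
  let f : L2 μ := hm.toLp _
  have hne : translation μ a f - f ≠ 0 := by
    intro h
    rw [sub_eq_zero] at h
    have h1 : (fun x => (f₀ (a * x) : ℂ)) =ᵐ[μ] fun x => (f₀ x : ℂ) := by
      have e : translation μ a f = _ := DomMulAct.mk_smul_toLp a hm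
      exact (MemLp.toLp_eq_toLp_iff _ _).1 (e.symm.trans h)
    have h2 := (Continuous.ae_eq_iff_eq μ (by fun_prop) (by fun_prop)).1 h1
    have h3 := congrFun h2 1
    have h4 : f₀ a = 0 := hf0 rfl
    have h5 : f₀ 1 = 1 := hf1 rfl
    simp [h4, h5] at h3
  obtain ⟨k, hk⟩ := exists_averaging_ne_zero μ hne
  refine exists_character_of_bicommutant (translation μ) (star_translation μ)
    (commute_averaging μ k) (continuous_translation_mul_averaging μ k) (a := a) fun h => hk ?_
  have h1 : (translation μ a - 1) * averaging μ k = averaging μ k * (translation μ a - 1) :=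
    commute_averaging μ k _ fun x => by
      rw [mul_sub, sub_mul, ← map_mul, mul_comm x a, map_mul, mul_one, one_mul]
  rw [h1] at h
  exact congrArg (fun R : L2 μ →L[ℂ] L2 μ => R f) h

/-! ### Uniqueness and inversion for the Fourier transform. -/

section Inversion

variable {G : Type*} [CommGroup G] [TopologicalSpace G] [IsTopologicalGroup G]
  [CompactSpace G] [T2Space G]

/-- A character as a continuous complex-valued function. -/
def charMap (γ : PontryaginDual G) : C(G, ℂ) :=
  ⟨fun x => (γ x : ℂ), continuous_subtype_val.comp (map_continuous γ)⟩

@[simp]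
theorem charMap_apply (γ : PontryaginDual G) (x : G) : charMap γ x = (γ x : ℂ) := rfl

theorem continuous_coe_char (γ : PontryaginDual G) : Continuous fun x => (γ x : ℂ) :=
  (charMap γ).continuous

theorem mul_char_apply (γ χ : PontryaginDual G) (x : G) :
    ((γ * χ) x : ℂ) = (γ x : ℂ) * (χ x : ℂ) := rfl

theorem inv_char_apply (γ : PontryaginDual G) (x : G) :
    (γ⁻¹ x : ℂ) = (starRingEnd ℂ) (γ x : ℂ) := by
  rw [← Circle.coe_inv_eq_conj]; rfl

/-- The linear span of the characters, as a star subalgebra of `C(G, ℂ)`. -/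
def charSubalgebra (G : Type*) [CommGroup G] [TopologicalSpace G] [IsTopologicalGroup G]
    [CompactSpace G] [T2Space G] : StarSubalgebra ℂ C(G, ℂ) where
  toSubalgebra := Algebra.adjoin ℂ (Set.range charMap)
  star_mem' := by
    change Algebra.adjoin ℂ (Set.range charMap) ≤ star (Algebra.adjoin ℂ (Set.range charMap))
    refine Algebra.adjoin_le ?_
    rintro _ ⟨γ, rfl⟩
    exact Algebra.subset_adjoin ⟨γ⁻¹, by ext x; exact inv_char_apply γ x⟩

theorem charSubalgebra_toSubmodule :
    (charSubalgebra G).toSubalgebra.toSubmodule = Submodule.span ℂ (Set.range charMap) := by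
  apply Algebra.adjoin_eq_span_of_subset
  refine Set.Subset.trans ?_ Submodule.subset_span
  intro x hx
  refine Submonoid.closure_induction (fun _ => id) ⟨1, rfl⟩ ?_ hx
  rintro _ _ - - ⟨m, rfl⟩ ⟨n, rfl⟩
  exact ⟨m * n, rfl⟩

theorem charSubalgebra_separatesPoints : (charSubalgebra G).SeparatesPoints := by
  intro x y hxy
  obtain ⟨χ, hχ⟩ := exists_character_ne_one (a := x * y⁻¹) (by rwa [Ne, mul_inv_eq_one])
  refine ⟨_, ⟨charMap χ, Algebra.subset_adjoin ⟨χ, rfl⟩, rfl⟩, fun h => hχ ?_⟩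
  have h1 : χ x = χ y := Subtype.ext h
  rw [map_mul, map_inv, h1, mul_inv_cancel]

theorem span_char_dense :
    (Submodule.span ℂ (Set.range (charMap (G := G)))).topologicalClosure = ⊤ := by
  rw [← charSubalgebra_toSubmodule]
  exact congr_arg (Subalgebra.toSubmodule <| StarSubalgebra.toSubalgebra ·)
    (ContinuousMap.starSubalgebra_topologicalClosure_eq_top_of_separatesPoints _
      charSubalgebra_separatesPoints)

variable [MeasurableSpace G] [BorelSpace G]
  (μ : Measure G) [IsHaarMeasure μ] [IsProbabilityMeasure μ]

theorem integrable_mul_continuous {f h : G → ℂ} (hf : Integrable f μ) (hh : Continuous h) :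
    Integrable (fun x => f x * h x) μ := by
  let k : C(G, ℂ) := ⟨h, hh⟩
  exact hf.mul_bdd (c := ‖k‖) (Continuous.integrable_of_compactSpace μ hh).aestronglyMeasurable
    (ae_of_all _ fun x => k.norm_coe_le_norm x)

theorem integral_char_eq_zero {γ : PontryaginDual G} (hγ : γ ≠ 1) : ∫ x, (γ x : ℂ) ∂μ = 0 := by
  obtain ⟨a, ha⟩ : ∃ a, γ a ≠ 1 := by
    by_contra! h
    exact hγ (PontryaginDual.ext h)
  have h1 : ∫ x, (γ (a * x) : ℂ) ∂μ = ∫ x, (γ x : ℂ) ∂μ :=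
    integral_mul_left_eq_self (fun x => (γ x : ℂ)) a
  simp only [map_mul, Circle.coe_mul, integral_const_mul] at h1
  have h2 : ((γ a : ℂ) - 1) * ∫ x, (γ x : ℂ) ∂μ = 0 := by rw [sub_mul, h1]; ring
  rcases mul_eq_zero.1 h2 with h | h
  · exact absurd (Subtype.ext (sub_eq_zero.1 h)) ha
  · exact h

/-- The functional `h ↦ ∫ f h dμ` on continuous functions. -/
def pairing {f : G → ℂ} (hf : Integrable f μ) : C(G, ℂ) →L[ℂ] ℂ :=
  LinearMap.mkContinuous
    { toFun := fun h => ∫ x, f x * h x ∂μ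
      map_add' := fun g h => by
        simp only [ContinuousMap.add_apply, mul_add]
        exact integral_add (integrable_mul_continuous μ hf g.continuous)
          (integrable_mul_continuous μ hf h.continuous)
      map_smul' := fun c h => by
        simp only [ContinuousMap.smul_apply, smul_eq_mul, mul_left_comm _ c, RingHom.id_apply]
        exact integral_const_mul c _ } (∫ x, ‖f x‖ ∂μ) (fun h => by
      rw [← integral_mul_const]
      refine norm_integral_le_of_norm_le (hf.norm.mul_const _) (ae_of_all _ fun x => ?_)
      rw [norm_mul]
      gcongr
      exact h.norm_coe_le_norm x)

theorem pairing_apply {f : G → ℂ} (hf : Integrable f μ) (h : C(G, ℂ)) :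
    pairing μ hf h = ∫ x, f x * h x ∂μ := rfl

theorem fourier_eq_pairing {f : G → ℂ} (hf : Integrable f μ) (γ : PontryaginDual G) :
    fourier μ f γ = pairing μ hf (charMap γ⁻¹) := by
  simp only [fourier, pairing_apply, charMap_apply, inv_char_apply]

theorem pairing_eq_zero {f : G → ℂ} (hf : Integrable f μ) (h : ∀ γ, fourier μ f γ = 0) :
    pairing μ hf = 0 := by
  have h1 : Submodule.span ℂ (Set.range (charMap (G := G))) ≤ LinearMap.ker (pairing μ hf).toLinearMap := by
    rw [Submodule.span_le]
    rintro _ ⟨γ, rfl⟩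
    have := h γ⁻¹
    rwa [fourier_eq_pairing μ hf, inv_inv] at this
  have h2 := Submodule.topologicalClosure_minimal _ h1 (pairing μ hf).isClosed_ker
  rw [span_char_dense] at h2
  ext1 g
  exact h2 (Submodule.mem_top (x := g))

/-- Uniqueness theorem for the Fourier transform on `L¹(G)`. -/
theorem ae_eq_zero_of_fourier_eq_zero {f : G → ℂ} (hf : Integrable f μ)
    (h : ∀ γ, fourier μ f γ = 0) : f =ᵐ[μ] 0 := by
  have := regular_of_isHaarMeasure_of_isProbabilityMeasure μ
  have key : ∀ e : ℝ, 0 < e → ∫ x, ‖f x‖ ∂μ ≤ 3 * e := by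
    intro e he
    obtain ⟨g, -, hfg, hg, hgi⟩ := hf.exists_hasCompactSupport_integral_sub_le he
    have hden : ∀ x, (0 : ℝ) < ‖g x‖ + e := fun x => by positivity
    -- A continuous substitute for the conjugate sign of `g`: `|s| ≤ 1` and `g s ≥ |g| - e`. As `f`
    -- pairs to zero with `s`, the `L¹` norm of `g`, and then of `f`, is small.
    let s : C(G, ℂ) := ⟨fun x => (starRingEnd ℂ) (g x) * ((‖g x‖ + e : ℝ) : ℂ)⁻¹, by
      refine (Complex.continuous_conj.comp hg).mul (Continuous.inv₀ (by fun_prop) fun x => ?_)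
      exact_mod_cast (hden x).ne'⟩
    have hs : ∀ x, ‖s x‖ ≤ 1 := by
      intro x
      simp only [s, ContinuousMap.coe_mk, norm_mul, norm_inv, RCLike.norm_conj, Complex.norm_real,
        Real.norm_of_nonneg (hden x).le]
      rw [← div_eq_mul_inv, div_le_one (hden x)]
      linarith
    have h0 : ∫ x, f x * s x ∂μ = 0 := by
      rw [← pairing_apply μ hf, pairing_eq_zero μ hf h]; rfl
    have h1 : ∫ x, (f x - g x) * s x ∂μ = - ∫ x, g x * s x ∂μ := by
      simp only [sub_mul]
      rw [integral_sub (integrable_mul_continuous μ hf s.continuous)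
        (integrable_mul_continuous μ hgi s.continuous), h0, zero_sub]
    have h2 : ‖∫ x, (f x - g x) * s x ∂μ‖ ≤ e := by
      refine (norm_integral_le_of_norm_le (hf.sub hgi).norm (ae_of_all _ fun x => ?_)).trans hfg
      rw [norm_mul]
      exact mul_le_of_le_one_right (norm_nonneg _) (hs x)
    have h3 : ∫ x, (‖g x‖ - e) ∂μ ≤ e := by
      have e1 : ∀ x, g x * s x = ((‖g x‖ ^ 2 / (‖g x‖ + e) : ℝ) : ℂ) := by
        intro x
        simp only [s, ContinuousMap.coe_mk]
        rw [← mul_assoc, Complex.mul_conj, Complex.normSq_eq_norm_sq]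
        push_cast
        rw [div_eq_mul_inv]
      rw [h1, norm_neg] at h2
      simp only [e1] at h2
      rw [integral_complex_ofReal, Complex.norm_real] at h2
      refine le_trans ?_ ((le_abs_self _).trans h2)
      refine integral_mono (hgi.norm.sub (integrable_const _)) ?_ fun x => ?_
      · exact Continuous.integrable_of_compactSpace μ
          ((by fun_prop : Continuous fun x => ‖g x‖ ^ 2).div (by fun_prop) fun x => (hden x).ne')
      · change ‖g x‖ - e ≤ ‖g x‖ ^ 2 / (‖g x‖ + e)
        rw [le_div_iff₀ (hden x)]
        nlinarith
    rw [integral_sub hgi.norm (integrable_const _)] at h3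
    simp only [integral_const, probReal_univ, smul_eq_mul, one_mul] at h3
    have h4 : ∫ x, ‖f x‖ ∂μ ≤ ∫ x, ‖f x - g x‖ ∂μ + ∫ x, ‖g x‖ ∂μ := by
      have hs : Integrable (fun x => ‖f x - g x‖) μ := (hf.sub hgi).norm
      rw [← integral_add hs hgi.norm]
      refine integral_mono hf.norm (hs.add hgi.norm) fun x => ?_
      simpa using norm_add_le (f x - g x) (g x)
    linarith
  have h0 : ∫ x, ‖f x‖ ∂μ = 0 := by
    refine le_antisymm (le_of_forall_pos_le_add fun e he => ?_)
      (integral_nonneg fun x => norm_nonneg _)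
    have := key (e / 3) (by positivity)
    linarith
  have h1 := (integral_eq_zero_iff_of_nonneg (fun x => norm_nonneg (f x)) hf.norm).1 h0
  filter_upwards [h1] with x hx
  simpa using hx

/-- The Fourier series of a function in `A(G)`. -/
def fourierSeries (f : G → ℂ) : C(G, ℂ) := ∑' γ, fourier μ f γ • charMap γ

theorem norm_charMap_le (γ : PontryaginDual G) : ‖charMap γ‖ ≤ 1 :=
  (ContinuousMap.norm_le _ zero_le_one).2 fun x => (Circle.norm_coe (γ x)).le

theorem hasSum_fourierSeries {f : G → ℂ} (hf : MemA μ f) :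
    HasSum (fun γ => fourier μ f γ • charMap γ) (fourierSeries μ f) := by
  refine (Summable.of_norm_bounded hf.2 fun γ => ?_).hasSum
  rw [norm_smul]
  exact mul_le_of_le_one_right (norm_nonneg _) (norm_charMap_le γ)

theorem fourier_fourierSeries {f : G → ℂ} (hf : MemA μ f) (χ : PontryaginDual G) :
    fourier μ (fourierSeries μ f) χ = fourier μ f χ := by
  classical
  have hi : Integrable (charMap χ⁻¹) μ :=
    Continuous.integrable_of_compactSpace μ (charMap χ⁻¹).continuous
  have h1 := (pairing μ hi).hasSum (hasSum_fourierSeries μ hf)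
  have h2 : ∀ γ, pairing μ hi (fourier μ f γ • charMap γ)
      = if γ = χ then fourier μ f χ else 0 := by
    intro γ
    rw [map_smul, pairing_apply, smul_eq_mul]
    simp only [charMap_apply, ← mul_char_apply]
    split_ifs with h
    · subst h
      simp
    · rw [integral_char_eq_zero μ (by rwa [Ne, inv_mul_eq_one, eq_comm]), mul_zero]
  simp only [h2] at h1
  have h3 := h1.unique (hasSum_ite_eq χ _)
  rw [← h3, pairing_apply, fourier]
  simp only [charMap_apply, inv_char_apply, mul_comm]

theorem ae_eq_fourierSeries {f : G → ℂ} (hf : MemA μ f) : f =ᵐ[μ] fourierSeries μ f := by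
  have hi : Integrable (fourierSeries μ f) μ :=
    Continuous.integrable_of_compactSpace μ (fourierSeries μ f).continuous
  have h := ae_eq_zero_of_fourier_eq_zero μ (hf.1.sub hi) fun γ => by
    have h1 := fourier_fourierSeries μ hf γ
    have hc : Continuous fun x => (starRingEnd ℂ) (γ x : ℂ) :=
      Complex.continuous_conj.comp (continuous_coe_char γ)
    rw [fourier] at h1 ⊢
    simp only [Pi.sub_apply, sub_mul]
    rw [integral_sub (integrable_mul_continuous μ hf.1 hc) (integrable_mul_continuous μ hi hc), h1,
      fourier, sub_self]
  filter_upwards [h] with x hx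
  exact sub_eq_zero.1 hx

theorem ae_norm_le_normA {f : G → ℂ} (hf : MemA μ f) : ∀ᵐ x ∂μ, ‖f x‖ ≤ normA μ f := by
  filter_upwards [ae_eq_fourierSeries μ hf] with x hx
  rw [hx]
  refine (ContinuousMap.norm_coe_le_norm _ x).trans ?_
  refine tsum_of_norm_bounded hf.2.hasSum fun γ => ?_
  rw [norm_smul]
  exact mul_le_of_le_one_right (norm_nonneg _) (norm_charMap_le γ)

/-- Duality between the `ℓ¹` norm of the transform of `f` and the supremum of the transform of `h`:
expand `f` in its Fourier series and integrate termwise. -/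
theorem norm_integral_mul_le_normA {f : G → ℂ} (hf : MemA μ f) {h : G → ℂ} (hh : Continuous h)
    {C : ℝ} (hC : ∀ γ : PontryaginDual G, ‖∫ x, h x * (γ x : ℂ) ∂μ‖ ≤ C) :
    ‖∫ x, f x * h x ∂μ‖ ≤ normA μ f * C := by
  have hi : Integrable h μ := Continuous.integrable_of_compactSpace μ hh
  have e : ∫ x, f x * h x ∂μ = pairing μ hi (fourierSeries μ f) := by
    rw [pairing_apply]
    refine integral_congr_ae ?_
    filter_upwards [ae_eq_fourierSeries μ hf] with x hx
    rw [hx, mul_comm]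
  rw [e]
  have h1 := (pairing μ hi).hasSum (hasSum_fourierSeries μ hf)
  rw [← h1.tsum_eq]
  refine tsum_of_norm_bounded (hf.2.hasSum.mul_right C) fun γ => ?_
  rw [map_smul, norm_smul]
  gcongr
  exact hC γ

end Inversion

/-! ### The derivative bound from the three lines theorem. -/

section Analytic

open Complex Complex.HadamardThreeLines

theorem normSq_cos_sub_normSq_sin (w : ℂ) :
    normSq (cos w) - normSq (sin w) = Real.cos (2 * w.re) := by
  have h : ((normSq (cos w) - normSq (sin w) : ℝ) : ℂ) = ((Real.cos (2 * w.re) : ℝ) : ℂ) := by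
    rw [ofReal_sub, ← mul_conj, ← mul_conj, ← cos_conj, ← sin_conj, ← cos_add, add_conj,
      ofReal_cos]
  exact_mod_cast h

theorem cos_two_mul_re_nonneg {w : ℂ} (hw : |w.re| ≤ Real.pi / 4) :
    0 ≤ Real.cos (2 * w.re) := by
  have := abs_le.1 hw
  exact Real.cos_nonneg_of_mem_Icc ⟨by linarith, by linarith⟩

theorem cos_ne_zero_of_abs_re_le {w : ℂ} (hw : |w.re| ≤ Real.pi / 4) : cos w ≠ 0 := by
  intro h
  have h1 := normSq_cos_sub_normSq_sin w
  have h2 := cos_two_mul_re_nonneg hw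
  rw [h, map_zero] at h1
  have h3 : sin w = 0 := normSq_eq_zero.1 (le_antisymm (by linarith) (normSq_nonneg _))
  have h4 := sin_sq_add_cos_sq w
  simp [h, h3] at h4

/-- Here `|cos w|² - |sin w|² = cos(2 Re w) ≥ 0`. -/
theorem norm_tan_le_one {w : ℂ} (hw : |w.re| ≤ Real.pi / 4) : ‖tan w‖ ≤ 1 := by
  have h1 := normSq_cos_sub_normSq_sin w
  have h2 := cos_two_mul_re_nonneg hw
  have h3 : 0 < ‖cos w‖ := norm_pos_iff.2 (cos_ne_zero_of_abs_re_le hw)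
  rw [tan_eq_sin_div_cos, norm_div, div_le_one h3]
  rw [normSq_eq_norm_sq, normSq_eq_norm_sq] at h1
  exact (sq_le_sq₀ (norm_nonneg _) (norm_nonneg _)).1 (by linarith)

/-- The conformal map of the strip `|Re z| < 1` onto the unit disc. -/
def stripMap (z : ℂ) : ℂ := -I * tan ((Real.pi / 4 : ℝ) * z)

theorem abs_re_le_of_abs_re_le_one {z : ℂ} (hz : |z.re| ≤ 1) :
    |((Real.pi / 4 : ℝ) * z : ℂ).re| ≤ Real.pi / 4 := by
  rw [re_ofReal_mul, abs_mul, abs_of_pos (by positivity)]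
  exact mul_le_of_le_one_right (by positivity) hz

theorem norm_stripMap_le_one {z : ℂ} (hz : |z.re| ≤ 1) : ‖stripMap z‖ ≤ 1 := by
  simpa [stripMap] using norm_tan_le_one (abs_re_le_of_abs_re_le_one hz)

theorem hasDerivAt_stripMap {z : ℂ} (hz : |z.re| ≤ 1) :
    HasDerivAt stripMap (-I * (1 / cos ((Real.pi / 4 : ℝ) * z) ^ 2 * (Real.pi / 4 : ℝ))) z := by
  have h := (hasDerivAt_tan (cos_ne_zero_of_abs_re_le (abs_re_le_of_abs_re_le_one hz))).comp z
    ((hasDerivAt_id z).const_mul ((Real.pi / 4 : ℝ) : ℂ))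
  rw [mul_one] at h
  exact h.const_mul (-I)

theorem stripMap_neg (z : ℂ) : stripMap (-z) = -stripMap z := by
  simp [stripMap, tan_neg]

theorem stripMap_zero : stripMap 0 = 0 := by simp [stripMap]

/-- On the imaginary axis `stripMap` is a hyperbolic tangent, so the axis lands in the real interval
where the better bound for `Q` holds. -/
theorem exists_stripMap_eq_ofReal {z : ℂ} (hz : z.re = 0) :
    ∃ t : ℝ, |t| ≤ 1 ∧ stripMap z = t := by
  have h1 : stripMap z = ((Real.tanh (Real.pi / 4 * z.im) : ℝ) : ℂ) := by
    have : ((Real.pi / 4 : ℝ) * z : ℂ) = ((Real.pi / 4 * z.im : ℝ) : ℂ) * I := by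
      apply Complex.ext <;> simp [hz]
    rw [stripMap, this, tan_mul_I, ofReal_tanh, mul_comm (tanh _) I, ← mul_assoc, neg_mul, I_mul_I,
      neg_neg, one_mul]
  refine ⟨_, ?_, h1⟩
  have h2 := norm_stripMap_le_one (z := z) (by simp [hz])
  rwa [h1, norm_real] at h2

/-- Three lines for `Q ∘ stripMap`: the bound is `a` on `Re z = 0` and `a * A` on `Re z = 1`. -/
theorem norm_comp_stripMap_le {Q : ℂ → ℂ} (hQ : Differentiable ℂ Q) {a A : ℝ} (ha : 0 < a)
    (hA : 1 ≤ A) (h1 : ∀ t : ℝ, |t| ≤ 1 → ‖Q t‖ ≤ a) (h2 : ∀ z : ℂ, ‖z‖ ≤ 1 → ‖Q z‖ ≤ a * A)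
    {z : ℂ} (hz0 : 0 ≤ z.re) (hz1 : z.re ≤ 1) : ‖Q (stripMap z)‖ ≤ a * A ^ z.re := by
  have hcl : IsClosed (verticalClosedStrip 0 1) := isClosed_Icc.preimage continuous_re
  have hmem : ∀ w ∈ verticalClosedStrip 0 1, |w.re| ≤ 1 := fun w hw =>
    abs_le.2 ⟨by linarith [hw.1], hw.2⟩
  have hd : DiffContOnCl ℂ (fun w => Q (stripMap w)) (verticalStrip 0 1) := by
    apply DifferentiableOn.diffContOnCl
    intro w hw
    have hw' : w ∈ verticalClosedStrip 0 1 :=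
      closure_minimal (show verticalStrip 0 1 ⊆ verticalClosedStrip 0 1 from fun u hu =>
        ⟨(show u.re ∈ Set.Ioo 0 1 from hu).1.le, (show u.re ∈ Set.Ioo 0 1 from hu).2.le⟩) hcl hw
    exact ((hQ _).comp w (hasDerivAt_stripMap (hmem w hw')).differentiableAt).differentiableWithinAt
  have h := norm_le_interp_of_mem_verticalClosedStrip' (f := fun w => Q (stripMap w)) (z := z) (l := 0) (u := 1)
    (a := a) (b := a * A) zero_lt_one ⟨hz0, hz1⟩ hd
    ⟨a * A, by
      rintro _ ⟨w, hw, rfl⟩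
      exact h2 _ (norm_stripMap_le_one (hmem w hw))⟩
    (fun w hw => by
      obtain ⟨t, ht, e⟩ := exists_stripMap_eq_ofReal hw
      simp only [e]
      exact h1 t ht)
    (fun w hw => h2 _ (norm_stripMap_le_one (by rw [show w.re = 1 from hw, abs_one])))
  refine h.trans_eq ?_
  simp only [sub_zero, div_one]
  rw [Real.mul_rpow ha.le (by linarith), ← mul_assoc, ← Real.rpow_add ha, sub_add_cancel,
    Real.rpow_one]

/-- A function bounded by `a` on `[-1, 1]` and by `a * A` on the unit disc has derivative
`O(a (1 + log A))` at the origin. -/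
theorem norm_deriv_zero_le {Q : ℂ → ℂ} (hQ : Differentiable ℂ Q) {a A : ℝ} (ha : 0 < a)
    (hA : 1 ≤ A) (h1 : ∀ t : ℝ, |t| ≤ 1 → ‖Q t‖ ≤ a) (h2 : ∀ z : ℂ, ‖z‖ ≤ 1 → ‖Q z‖ ≤ a * A) :
    ‖deriv Q 0‖ ≤ 4 * (a * (1 + Real.log A)) := by
  have hlog : 0 ≤ Real.log A := Real.log_nonneg hA
  -- On the disc of this radius `A ^ |Re w| ≤ e`, so Cauchy's estimate loses only a factor `1 + log
  -- A`. The derivative of `stripMap` at 0 has modulus `π/4`, and `e ≤ π` leaves the constant 4.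
  set r : ℝ := 1 / (1 + Real.log A) with hr
  have hr0 : 0 < r := by positivity
  have hr1 : r ≤ 1 := by rw [hr, div_le_one (by positivity)]; linarith
  have hre : ∀ w ∈ Metric.closedBall (0 : ℂ) r, |w.re| ≤ r := fun w hw =>
    (abs_re_le_norm w).trans (by simpa using hw)
  have hd : DiffContOnCl ℂ (fun w => Q (stripMap w)) (Metric.ball 0 r) := by
    apply DifferentiableOn.diffContOnCl
    intro w hw
    have hw' := hre w (Metric.closure_ball_subset_closedBall hw)
    exact ((hQ _).comp w
      (hasDerivAt_stripMap (hw'.trans hr1)).differentiableAt).differentiableWithinAt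
  have hpow : ∀ s, s ≤ r → A ^ s ≤ Real.exp 1 := by
    intro s hs
    rw [Real.rpow_def_of_pos (by linarith)]
    apply Real.exp_le_exp.2
    calc Real.log A * s ≤ Real.log A * r := by gcongr
      _ ≤ 1 := by rw [hr, mul_one_div, div_le_one (by positivity)]; linarith
  have hb : ∀ w ∈ Metric.sphere (0 : ℂ) r, ‖Q (stripMap w)‖ ≤ a * Real.exp 1 := by
    intro w hw
    have hw' := hre w (Metric.sphere_subset_closedBall hw)
    have hw1 := abs_le.1 hw'
    rcases le_total 0 w.re with h | h
    · refine (norm_comp_stripMap_le hQ ha hA h1 h2 h (by linarith)).trans ?_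
      gcongr
      exact hpow _ hw1.2
    · have e : Q (stripMap w) = (fun u => Q (-u)) (stripMap (-w)) := by
        simp [stripMap_neg]
      rw [e]
      refine (norm_comp_stripMap_le (z := -w) (hQ.comp differentiable_neg) ha hA
        (fun t ht => ?_) (fun u hu => h2 _ (by rwa [norm_neg])) (by simpa using h)
        (by rw [neg_re]; linarith)).trans ?_
      · have := h1 (-t) (by rwa [abs_neg])
        rwa [ofReal_neg] at this
      · gcongr
        exact hpow _ (by rw [neg_re]; linarith)
  have hder : deriv (fun w => Q (stripMap w)) 0 = deriv Q 0 * (-I * (Real.pi / 4 : ℝ)) := by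
    have e1 := hasDerivAt_stripMap (z := 0) (by simp)
    rw [mul_zero, cos_zero, one_pow, div_one, one_mul] at e1
    have e2 : HasDerivAt Q (deriv Q 0) (stripMap 0) := by
      rw [stripMap_zero]; exact (hQ 0).hasDerivAt
    exact (e2.comp 0 e1).deriv
  have h := norm_deriv_le_of_forall_mem_sphere_norm_le hr0 hd hb
  rw [hder, norm_mul, norm_mul, norm_neg, norm_I, one_mul, norm_real,
    Real.norm_of_nonneg (by positivity), hr, div_div_eq_mul_div, div_one] at h
  have hpi := Real.pi_gt_three
  have he := Real.exp_one_lt_d9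
  have h3 : ‖deriv Q 0‖ * Real.pi ≤ 4 * (a * (1 + Real.log A)) * Real.exp 1 := by linarith
  have h4 : 0 ≤ 4 * (a * (1 + Real.log A)) := by positivity
  have h5 : ‖deriv Q 0‖ * 3 ≤ 4 * (a * (1 + Real.log A)) * 3 :=
    calc ‖deriv Q 0‖ * 3 ≤ ‖deriv Q 0‖ * Real.pi := by gcongr
      _ ≤ 4 * (a * (1 + Real.log A)) * Real.exp 1 := h3
      _ ≤ _ := by gcongr; linarith
  linarith

end Analytic

/-! ### The valuation on the circle as a translation-invariant metric. -/

section CircleVal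

theorem circleVal_eq_angle (z : Circle) :
    circleVal z = InnerProductGeometry.angle (1 : ℂ) z / (2 * Real.pi) := by
  rw [circleVal_eq, Complex.angle_one_left z.coe_ne_zero]

theorem circleVal_nonneg (z : Circle) : 0 ≤ circleVal z := by
  rw [circleVal_eq]; positivity

theorem circleVal_le_half (z : Circle) : circleVal z ≤ 1 / 2 := by
  rw [circleVal_eq, div_le_iff₀ (by positivity)]
  linarith [Complex.abs_arg_le_pi (z : ℂ)]

theorem circleVal_one : circleVal 1 = 0 := by simp [circleVal_eq]

theorem circleVal_mul_le (z w : Circle) : circleVal (z * w) ≤ circleVal z + circleVal w := by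
  simp only [circleVal_eq_angle]
  rw [← add_div]
  gcongr
  refine (InnerProductGeometry.angle_le_angle_add_angle 1 (z : ℂ) _).trans ?_
  gcongr
  have := Complex.angle_mul_left z.coe_ne_zero 1 w
  rw [mul_one] at this
  rw [Circle.coe_mul, this]

theorem circleVal_inv (z : Circle) : circleVal z⁻¹ = circleVal z := by
  rw [circleVal_eq, circleVal_eq, Circle.coe_inv, Complex.abs_arg_inv]

theorem continuous_circleVal : Continuous circleVal := by
  have h : circleVal = fun z : Circle => InnerProductGeometry.angle (1 : ℂ) z / (2 * Real.pi) :=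
    funext circleVal_eq_angle
  rw [h, continuous_iff_continuousAt]
  intro z
  have h1 : ContinuousAt (fun z : Circle => ((1 : ℂ), (z : ℂ))) z :=
    (continuous_const.prodMk continuous_subtype_val).continuousAt
  exact ((InnerProductGeometry.continuousAt_angle one_ne_zero z.coe_ne_zero).comp_of_eq h1
    rfl).div_const _

theorem norm_one_sub_le_circleVal (z : Circle) : ‖(1 : ℂ) - z‖ ≤ 2 * Real.pi * circleVal z := by
  refine (Complex.norm_sub_le_angle norm_one (Circle.norm_coe z)).trans_eq ?_
  rw [circleVal_eq_angle]
  field_simp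

/-- If the difference of arguments is less than `π` in modulus it is the argument of the quotient;
otherwise the right side is at least `1/2`. -/
theorem circleVal_div_le (z w : Circle) :
    circleVal (z / w) ≤ |Complex.arg (z : ℂ) - Complex.arg (w : ℂ)| / (2 * Real.pi) := by
  set t := Complex.arg (z : ℂ) - Complex.arg (w : ℂ) with ht
  have e : z / w = Circle.exp t := by
    rw [ht, Circle.exp_sub, Circle.exp_arg, Circle.exp_arg]
  rcases lt_or_ge |t| Real.pi with h | h
  · obtain ⟨h1, h2⟩ := abs_lt.1 h
    rw [e, circleVal_eq, Circle.arg_exp h1 h2.le]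
  · refine (circleVal_le_half _).trans ?_
    rw [le_div_iff₀ (by positivity)]
    linarith

end CircleVal

/-! ### Bohr sets: gauge, doubling and slowly growing radii. -/

section Bohr

variable {G : Type*} [CommGroup G] [TopologicalSpace G] [IsTopologicalGroup G]
  [CompactSpace G] [T2Space G] {Γ : Finset (PontryaginDual G)} (hΓ : Γ.Nonempty)

/-- The gauge `x ↦ max_{γ ∈ Γ} ‖γ(x)‖` whose sublevel sets are the Bohr sets. -/
def bohrGauge (x : G) : ℝ := Γ.sup' hΓ fun γ => circleVal (γ x)

theorem bohrGauge_le_iff {x : G} {r : ℝ} :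
    bohrGauge hΓ x ≤ r ↔ ∀ γ ∈ Γ, circleVal (γ x) ≤ r := Finset.sup'_le_iff _ _

theorem mem_bohrSet_iff {x : G} {r : ℝ} :
    x ∈ bohrSet (Γ : Set (PontryaginDual G)) r ↔ bohrGauge hΓ x ≤ r :=
  (bohrGauge_le_iff hΓ).symm

theorem circleVal_le_bohrGauge {γ : PontryaginDual G} (hγ : γ ∈ Γ) (x : G) :
    circleVal (γ x) ≤ bohrGauge hΓ x := 
  (bohrGauge_le_iff hΓ).1 le_rfl γ hγ

theorem bohrGauge_nonneg (x : G) : 0 ≤ bohrGauge hΓ x := by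
  obtain ⟨γ, hγ⟩ := id hΓ
  exact (circleVal_nonneg _).trans (circleVal_le_bohrGauge hΓ hγ x)

theorem bohrGauge_one : bohrGauge hΓ 1 = 0 :=
  le_antisymm ((bohrGauge_le_iff hΓ).2 fun γ _ => by rw [map_one, circleVal_one])
    (bohrGauge_nonneg hΓ 1)

theorem bohrGauge_mul_le (x y : G) : bohrGauge hΓ (x * y) ≤ bohrGauge hΓ x + bohrGauge hΓ y := by
  rw [bohrGauge_le_iff]
  intro γ hγ
  rw [map_mul]
  exact (circleVal_mul_le _ _).trans
    (add_le_add (circleVal_le_bohrGauge hΓ hγ x) (circleVal_le_bohrGauge hΓ hγ y))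

theorem bohrGauge_inv (x : G) : bohrGauge hΓ x⁻¹ = bohrGauge hΓ x := by
  simp only [bohrGauge, map_inv, circleVal_inv]

theorem continuous_bohrGauge : Continuous (bohrGauge hΓ) :=
  Continuous.finset_sup'_apply hΓ fun γ _ => continuous_circleVal.comp (map_continuous γ)

theorem isClosed_bohrSet (Γ : Set (PontryaginDual G)) (r : ℝ) : IsClosed (bohrSet Γ r) := by
  have : bohrSet Γ r = ⋂ γ ∈ Γ, {x | circleVal (γ x) ≤ r} := by
    ext x; simp [bohrSet]
  rw [this]
  exact isClosed_biInter fun γ _ =>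
    isClosed_le (continuous_circleVal.comp (map_continuous γ)) continuous_const

theorem bohrSet_mono (Γ : Set (PontryaginDual G)) {r s : ℝ} (h : r ≤ s) :
    bohrSet Γ r ⊆ bohrSet Γ s := fun _ hx γ hγ => (hx γ hγ).trans h

variable [MeasurableSpace G] [BorelSpace G]
  (μ : Measure G) [IsHaarMeasure μ] [IsProbabilityMeasure μ]

theorem measureReal_bohrSet_pos (hΓ : Γ.Nonempty) {r : ℝ} (hr : 0 < r) :
    0 < μ.real (bohrSet (Γ : Set (PontryaginDual G)) r) := by
  have hU : IsOpen {x | bohrGauge hΓ x < r} := isOpen_lt (continuous_bohrGauge hΓ) continuous_const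
  have h1 : 0 < μ {x | bohrGauge hΓ x < r} :=
    hU.measure_pos μ ⟨1, by simpa [bohrGauge_one] using hr⟩
  have h2 : {x | bohrGauge hΓ x < r} ⊆ bohrSet (Γ : Set (PontryaginDual G)) r :=
    fun x hx => (mem_bohrSet_iff hΓ).2 (le_of_lt hx)
  exact ENNReal.toReal_pos (h1.trans_le (measure_mono h2)).ne' (measure_ne_top _ _)

/-- Sort the points by the integer parts of `arg γ(x) / (2πr)`, which lie in `{-2, ..., 2}` for each
`γ`. Two points of one cell differ by an element of the Bohr set of radius `r`, so `5^|Γ|`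
translates cover. -/
theorem measureReal_bohrSet_two_mul_le (Γ : Finset (PontryaginDual G)) {r : ℝ} (hr : 0 < r) :
    μ.real (bohrSet (Γ : Set (PontryaginDual G)) (2 * r))
      ≤ 5 ^ Γ.card * μ.real (bohrSet (Γ : Set (PontryaginDual G)) r) := by
  classical
  set B := bohrSet (Γ : Set (PontryaginDual G)) with hB
  have hpi := Real.pi_pos
  let θ : G → Γ → ℝ := fun x γ => Complex.arg (γ.1 x : ℂ) / (2 * Real.pi * r)
  let c : G → Γ → ℤ := fun x γ => ⌊θ x γ⌋
  let M : Finset (Γ → ℤ) := Fintype.piFinset fun _ => Finset.Icc (-2) 2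
  have hM : M.card = 5 ^ Γ.card := by
    rw [Fintype.card_piFinset]; simp
  have hcM : ∀ x ∈ B (2 * r), c x ∈ M := by
    intro x hx
    rw [Fintype.mem_piFinset]
    intro γ
    have h1 : circleVal (γ.1 x) ≤ 2 * r := hx γ.1 γ.2
    rw [circleVal_eq, div_le_iff₀ (by positivity)] at h1
    have h2 : |θ x γ| ≤ 2 := by
      rw [abs_div, abs_of_pos (by positivity : 0 < 2 * Real.pi * r), div_le_iff₀ (by positivity)]
      linarith
    obtain ⟨h3, h4⟩ := abs_le.1 h2
    rw [Finset.mem_Icc]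
    refine ⟨Int.le_floor.2 (by exact_mod_cast h3), ?_⟩
    have : ((⌊θ x γ⌋ : ℤ) : ℝ) ≤ (2 : ℤ) := (Int.floor_le _).trans (by exact_mod_cast h4)
    exact_mod_cast this
  have hcell : ∀ x y, c x = c y → x⁻¹ * y ∈ B r := by
    intro x y hxy γ hγ
    have h1 : |θ y ⟨γ, hγ⟩ - θ x ⟨γ, hγ⟩| < 1 :=
      Int.abs_sub_lt_one_of_floor_eq_floor (congrFun hxy.symm ⟨γ, hγ⟩)
    rw [map_mul, map_inv, mul_comm, ← div_eq_mul_inv]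
    refine (circleVal_div_le _ _).trans ?_
    rw [← sub_div, abs_div, abs_of_pos (by positivity : 0 < 2 * Real.pi * r),
      div_lt_iff₀ (by positivity)] at h1
    rw [div_le_iff₀ (by positivity)]
    linarith
  have hcell' : ∀ m ∈ M, μ.real {x | x ∈ B (2 * r) ∧ c x = m} ≤ μ.real (B r) := by
    intro m _
    rcases Set.eq_empty_or_nonempty {x | x ∈ B (2 * r) ∧ c x = m} with h | ⟨y, hy⟩
    · rw [h, measureReal_empty]; exact measureReal_nonneg
    · have h1 : {x | x ∈ B (2 * r) ∧ c x = m} ⊆ (fun x => y⁻¹ * x) ⁻¹' B r :=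
        fun x hx => hcell y x (hy.2.trans hx.2.symm)
      calc _ ≤ μ.real ((fun x => y⁻¹ * x) ⁻¹' B r) := measureReal_mono h1
        _ = μ.real (B r) := by rw [measureReal_def, measure_preimage_mul, measureReal_def]
  have hcov : B (2 * r) ⊆ ⋃ m ∈ M, {x | x ∈ B (2 * r) ∧ c x = m} := fun x hx =>
    Set.mem_iUnion₂.2 ⟨c x, hcM x hx, hx, rfl⟩
  calc μ.real (B (2 * r)) ≤ μ.real (⋃ m ∈ M, {x | x ∈ B (2 * r) ∧ c x = m}) :=
        measureReal_mono hcov (measure_ne_top _ _)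
    _ ≤ ∑ m ∈ M, μ.real {x | x ∈ B (2 * r) ∧ c x = m} := measureReal_biUnion_finset_le _ _
    _ ≤ ∑ m ∈ M, μ.real (B r) := Finset.sum_le_sum hcell'
    _ = _ := by rw [Finset.sum_const, hM, nsmul_eq_mul]; push_cast; rfl

/-- By pigeonhole some radius between `r` and `2r` is slowly growing. -/
theorem exists_slow_growth (hΓ : Γ.Nonempty) {r τ : ℝ} (hr : 0 < r) (hτ : 0 < τ) {J : ℕ}
    (hJ0 : 0 < J) (hJ : 2 * (Γ.card : ℝ) ≤ J * Real.log (1 + τ)) :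
    ∃ t, r ≤ t ∧ t + r / J ≤ 2 * r ∧
      μ.real (bohrSet (Γ : Set (PontryaginDual G)) (t + r / J))
        ≤ (1 + τ) * μ.real (bohrSet (Γ : Set (PontryaginDual G)) t) := by
  set m : ℝ → ℝ := fun t => μ.real (bohrSet (Γ : Set (PontryaginDual G)) t) with hm
  have hJr : (0 : ℝ) < J := by exact_mod_cast hJ0
  have hrJ : (J : ℝ) * (r / J) = r := by field_simp
  have hrJ0 : 0 < r / J := by positivity
  by_contra! hcon
  -- If all `J` steps from `r` to `2r` grew by more than `1 + τ`, the total growth would be at least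
  -- `e^{2|Γ|}`, exceeding the doubling constant `5^|Γ|` because `5 < e²`.
  have step : ∀ j : ℕ, j ≤ J → (1 + τ) ^ j * m r ≤ m (r + j * (r / J)) := by
    intro j
    induction j with
    | zero => intro _; simp
    | succ j ih =>
      intro hj
      have hj' : ((j : ℝ) + 1) ≤ J := by exact_mod_cast hj
      have h1 := hcon (r + j * (r / J)) (by have : 0 ≤ j * (r / J) := by positivity
                                            linarith) (by nlinarith)
      have h2 := ih (by omega)
      calc (1 + τ) ^ (j + 1) * m r = (1 + τ) * ((1 + τ) ^ j * m r) := by ring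
        _ ≤ (1 + τ) * m (r + j * (r / J)) := by gcongr
        _ ≤ m (r + j * (r / J) + r / J) := h1.le
        _ = _ := by push_cast; ring_nf
  have h0 : 0 < m r := measureReal_bohrSet_pos μ hΓ hr
  have h1 := step J le_rfl
  rw [hrJ, ← two_mul] at h1
  have h2 : (1 + τ) ^ J * m r ≤ 5 ^ Γ.card * m r :=
    h1.trans (measureReal_bohrSet_two_mul_le μ Γ hr)
  have h3 : (1 + τ) ^ J ≤ 5 ^ Γ.card := le_of_mul_le_mul_right h2 h0
  have h4 : Real.exp (2 * Γ.card) ≤ (1 + τ) ^ J := by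
    rw [← Real.exp_log (by positivity : (0 : ℝ) < (1 + τ) ^ J), Real.log_pow]
    exact Real.exp_le_exp.2 hJ
  have h5 : (5 : ℝ) ^ Γ.card < Real.exp (2 * Γ.card) := by
    rw [mul_comm, Real.exp_nat_mul]
    refine pow_lt_pow_left₀ ?_ (by norm_num) hΓ.card_pos.ne'
    have he := Real.exp_one_gt_d9
    have : Real.exp 2 = Real.exp 1 * Real.exp 1 := by rw [← Real.exp_add]; norm_num
    rw [this]
    nlinarith
  linarith

end Bohr

/-! ### Convolution powers and smooth kernels on Bohr sets. -/

section Convolution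

variable {G : Type*} [CommGroup G] [TopologicalSpace G] [IsTopologicalGroup G]
  [CompactSpace G] [T2Space G] [MeasurableSpace G] [BorelSpace G]
  (μ : Measure G) [IsHaarMeasure μ] [IsProbabilityMeasure μ]

/-- The integral of a real function against a character. -/
def charInt (u : G → ℝ) (γ : PontryaginDual G) : ℂ := ∫ x, (u x : ℂ) * (γ x : ℂ) ∂μ

theorem charInt_one (u : G → ℝ) : charInt μ u 1 = ((∫ x, u x ∂μ : ℝ) : ℂ) := by
  simp only [charInt, PontryaginDual.one_apply, Circle.coe_one, mul_one]
  exact integral_complex_ofReal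

theorem norm_charInt_le {u : G → ℝ} (hu : Continuous u) (hu0 : ∀ x, 0 ≤ u x)
    (γ : PontryaginDual G) : ‖charInt μ u γ‖ ≤ ∫ x, u x ∂μ := by
  refine norm_integral_le_of_norm_le (Continuous.integrable_of_compactSpace μ hu)
    (ae_of_all _ fun x => ?_)
  rw [norm_mul, Circle.norm_coe, mul_one, Complex.norm_real, Real.norm_of_nonneg (hu0 x)]

/-- Conjugation matches inversion of the variable. A real transform is what makes even convolution
powers have nonnegative transform. -/
theorem charInt_im_eq_zero {u : G → ℝ} (hsymm : ∀ x, u x⁻¹ = u x)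
    (γ : PontryaginDual G) : (charInt μ u γ).im = 0 := by
  have := regular_of_isHaarMeasure_of_isProbabilityMeasure μ
  rw [← Complex.conj_eq_iff_im, charInt, ← integral_conj,
    ← integral_inv_eq_self (fun x => (u x : ℂ) * (γ x : ℂ)) μ]
  refine integral_congr_ae (ae_of_all _ fun x => ?_)
  simp only [map_mul, Complex.conj_ofReal, hsymm, map_inv, Circle.coe_inv_eq_conj]

theorem charInt_translate (u : G → ℝ) (γ : PontryaginDual G) (y : G) :
    ∫ x, (u (y⁻¹ * x) : ℂ) * (γ x : ℂ) ∂μ = (γ y : ℂ) * charInt μ u γ := by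
  rw [← integral_mul_left_eq_self _ y, charInt, ← integral_const_mul]
  refine integral_congr_ae (ae_of_all _ fun x => ?_)
  simp only [inv_mul_cancel_left, map_mul, Circle.coe_mul]
  ring

/-- Convolution of real functions on `G`. -/
def conv (k h : G → ℝ) (x : G) : ℝ := ∫ y, k y * h (y⁻¹ * x) ∂μ

theorem continuous_conv {k h : G → ℝ} (hk : Continuous k) (hh : Continuous h) :
    Continuous (conv μ k h) := by
  rw [← continuousOn_univ]
  exact continuousOn_integral_of_compact_support isCompact_univ (by fun_prop)
    (fun p x _ hx => absurd (Set.mem_univ x) hx)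

theorem conv_nonneg {k h : G → ℝ} (hk : ∀ x, 0 ≤ k x) (hh : ∀ x, 0 ≤ h x) (x : G) :
    0 ≤ conv μ k h x := integral_nonneg fun y => mul_nonneg (hk y) (hh _)

theorem conv_le_one {k h : G → ℝ} (hkc : Continuous k) (hhc : Continuous h) (hk : ∀ x, 0 ≤ k x)
    (hk1 : ∫ x, k x ∂μ = 1) (hh : ∀ x, h x ≤ 1) (x : G) : conv μ k h x ≤ 1 := by
  rw [← hk1]
  refine integral_mono (Continuous.integrable_of_compactSpace μ (by fun_prop))
    (Continuous.integrable_of_compactSpace μ hkc) fun y => ?_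
  exact mul_le_of_le_one_right (hk y) (hh _)

theorem exists_ne_zero_of_conv_ne_zero {k h : G → ℝ} {x : G} (hx : conv μ k h x ≠ 0) :
    ∃ y, k y ≠ 0 ∧ h (y⁻¹ * x) ≠ 0 := by
  by_contra! hcon
  apply hx
  rw [conv, integral_eq_zero_of_ae]
  refine ae_of_all _ fun y => ?_
  by_cases hy : k y = 0
  · simp [hy]
  · simp [hcon y hy]

theorem charInt_conv {k h : G → ℝ} (hk : Continuous k) (hh : Continuous h)
    (γ : PontryaginDual G) :
    charInt μ (conv μ k h) γ = charInt μ k γ * charInt μ h γ := by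
  have hγ := continuous_coe_char γ
  have e1 : charInt μ (conv μ k h) γ
      = ∫ x, (∫ y, ((k y : ℂ) * (h (y⁻¹ * x) : ℂ)) * (γ x : ℂ) ∂μ) ∂μ := by
    refine integral_congr_ae (ae_of_all _ fun x => ?_)
    have e0 : ((conv μ k h x : ℝ) : ℂ) = ∫ y, (k y : ℂ) * (h (y⁻¹ * x) : ℂ) ∂μ := by
      rw [conv, ← integral_complex_ofReal]
      simp only [Complex.ofReal_mul]
    exact (congrArg (· * (γ x : ℂ)) e0).trans (integral_mul_const _ _).symm
  rw [e1, integral_integral_swap_of_hasCompactSupport (by fun_prop)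
    (HasCompactSupport.of_compactSpace _)]
  rw [charInt, ← integral_mul_const]
  refine integral_congr_ae (ae_of_all _ fun y => ?_)
  simp only [mul_assoc]
  rw [integral_const_mul, charInt_translate]

theorem continuous_iterate_conv {k h : G → ℝ} (hk : Continuous k) (hh : Continuous h) (n : ℕ) :
    Continuous ((conv μ k)^[n] h) := by
  induction n with
  | zero => exact hh
  | succ n ih => rw [Function.iterate_succ_apply']; exact continuous_conv μ hk ih

theorem iterate_conv_nonneg {k h : G → ℝ} (hk : ∀ x, 0 ≤ k x) (hh : ∀ x, 0 ≤ h x) (n : ℕ) (x : G) :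
    0 ≤ (conv μ k)^[n] h x := by
  induction n generalizing x with
  | zero => exact hh x
  | succ n ih => rw [Function.iterate_succ_apply']; exact conv_nonneg μ hk ih x

theorem iterate_conv_le_one {k h : G → ℝ} (hkc : Continuous k) (hhc : Continuous h)
    (hk : ∀ x, 0 ≤ k x) (hk1 : ∫ x, k x ∂μ = 1) (hh : ∀ x, h x ≤ 1) (n : ℕ) (x : G) :
    (conv μ k)^[n] h x ≤ 1 := by
  induction n generalizing x with
  | zero => exact hh x
  | succ n ih =>
    rw [Function.iterate_succ_apply']
    exact conv_le_one μ hkc (continuous_iterate_conv μ hkc hhc n) hk hk1 ih x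

theorem charInt_iterate_conv {k h : G → ℝ} (hk : Continuous k) (hh : Continuous h) (n : ℕ)
    (γ : PontryaginDual G) :
    charInt μ ((conv μ k)^[n] h) γ = charInt μ k γ ^ n * charInt μ h γ := by
  induction n with
  | zero => simp
  | succ n ih =>
    rw [Function.iterate_succ_apply', charInt_conv μ hk (continuous_iterate_conv μ hk hh n), ih]
    ring

theorem integral_iterate_conv {k h : G → ℝ} (hk : Continuous k) (hh : Continuous h)
    (hk1 : ∫ x, k x ∂μ = 1) (n : ℕ) : ∫ x, (conv μ k)^[n] h x ∂μ = ∫ x, h x ∂μ := by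
  have h1 := charInt_iterate_conv μ hk hh n 1
  rw [charInt_one, charInt_one, charInt_one, hk1, Complex.ofReal_one, one_pow, one_mul] at h1
  exact_mod_cast h1

variable {Γ : Finset (PontryaginDual G)} (hΓ : Γ.Nonempty)

theorem bohrGauge_le_of_iterate_conv_ne_zero {k h : G → ℝ} {r s : ℝ}
    (hk : ∀ x, k x ≠ 0 → bohrGauge hΓ x ≤ r) (hh : ∀ x, h x ≠ 0 → bohrGauge hΓ x ≤ s) (n : ℕ)
    {x : G} (hx : (conv μ k)^[n] h x ≠ 0) : bohrGauge hΓ x ≤ n * r + s := by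
  induction n generalizing x with
  | zero => simpa using hh x hx
  | succ n ih =>
    rw [Function.iterate_succ_apply'] at hx
    obtain ⟨y, hy1, hy2⟩ := exists_ne_zero_of_conv_ne_zero μ hx
    have h1 := bohrGauge_mul_le hΓ y (y⁻¹ * x)
    rw [mul_inv_cancel_left] at h1
    have h2 := hk y hy1
    have h3 := ih hy2
    push_cast
    linarith

/-- A continuous cutoff, equal to `1` on the Bohr set of radius `a` and to `0` off that of
radius `b`. -/
def bump (a b : ℝ) (x : G) : ℝ := max 0 (min 1 ((b - bohrGauge hΓ x) / (b - a)))

theorem continuous_bump (a b : ℝ) : Continuous (bump hΓ a b) := by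
  have := continuous_bohrGauge hΓ
  unfold bump
  fun_prop

theorem bump_nonneg (a b : ℝ) (x : G) : 0 ≤ bump hΓ a b x := le_max_left _ _

theorem bump_le_one (a b : ℝ) (x : G) : bump hΓ a b x ≤ 1 :=
  max_le zero_le_one (min_le_left _ _)

theorem bump_inv (a b : ℝ) (x : G) : bump hΓ a b x⁻¹ = bump hΓ a b x := by
  simp only [bump, bohrGauge_inv]

theorem bump_eq_one {a b : ℝ} (hab : a < b) {x : G} (hx : bohrGauge hΓ x ≤ a) :
    bump hΓ a b x = 1 := by
  have : 1 ≤ (b - bohrGauge hΓ x) / (b - a) := by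
    rw [le_div_iff₀ (by linarith)]; linarith
  rw [bump, min_eq_left this]
  norm_num

theorem bump_eq_zero {a b : ℝ} (hab : a < b) {x : G} (hx : b ≤ bohrGauge hΓ x) :
    bump hΓ a b x = 0 := by
  have : (b - bohrGauge hΓ x) / (b - a) ≤ 0 :=
    div_nonpos_of_nonpos_of_nonneg (by linarith) (by linarith)
  exact max_eq_left ((min_le_right _ _).trans this)

theorem bohrGauge_lt_of_bump_ne_zero {a b : ℝ} (hab : a < b) {x : G} (hx : bump hΓ a b x ≠ 0) :
    bohrGauge hΓ x < b := by
  by_contra! h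
  exact hx (bump_eq_zero hΓ hab h)

theorem measureReal_le_integral_of_one_le {s : Set G} (hs : MeasurableSet s) {u : G → ℝ}
    (hu : Continuous u) (hu0 : ∀ x, 0 ≤ u x) (h : ∀ x ∈ s, 1 ≤ u x) :
    μ.real s ≤ ∫ x, u x ∂μ := by
  rw [← integral_indicator_one hs]
  refine integral_mono ((integrable_const (1 : ℝ)).indicator hs)
    (Continuous.integrable_of_compactSpace μ hu) fun x => ?_
  by_cases hx : x ∈ s
  · simpa [hx] using h x hx
  · simpa [hx] using hu0 x

theorem integral_le_measureReal_of_le_indicator {s : Set G} (hs : MeasurableSet s) {u : G → ℝ}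
    (hu : Continuous u) (hu1 : ∀ x, u x ≤ 1) (h : ∀ x, u x ≠ 0 → x ∈ s) :
    ∫ x, u x ∂μ ≤ μ.real s := by
  rw [← integral_indicator_one hs]
  refine integral_mono (Continuous.integrable_of_compactSpace μ hu)
    ((integrable_const (1 : ℝ)).indicator hs) fun x => ?_
  by_cases hx : x ∈ s
  · simpa [hx] using hu1 x
  · have : u x = 0 := by_contra fun h0 => hx (h x h0)
    simp [hx, this]

/-- A smooth probability density on a Bohr set whose large spectrum is annihilated, up to `η / 2`,
by a smaller Bohr set with the same frequencies. -/
theorem exists_kernel {r η : ℝ} (hr : 0 < r) (hη : 0 < η) (hη1 : η ≤ 1) :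
    ∃ k : G → ℝ, Continuous k ∧ (∀ x, 0 ≤ k x) ∧ (∀ x, k x⁻¹ = k x) ∧ ∫ x, k x ∂μ = 1 ∧
      (∀ x, k x ≠ 0 → bohrGauge hΓ x ≤ 2 * r) ∧
      ∀ γ : PontryaginDual G, 1 / 2 < ‖charInt μ k γ‖ →
        ∀ y, bohrGauge hΓ y ≤ r * η / (51 * Γ.card) → ‖(1 : ℂ) - (γ y : ℂ)‖ ≤ η / 2 := by
  have hd : (1 : ℝ) ≤ Γ.card := by exact_mod_cast hΓ.card_pos
  -- Growth rate `τ = η/4` has `log(1 + τ) ≥ η/8`, so `exists_slow_growth` needs `J ≥ 16|Γ|/η`. The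
  -- upper bound `17|Γ|/η` gives the 51 = 3 · 17 of the statement.
  set J : ℕ := ⌈16 * (Γ.card : ℝ) / η⌉₊ with hJdef
  have hJ1 : 16 * (Γ.card : ℝ) / η ≤ J := Nat.le_ceil _
  have hJ2 : (J : ℝ) ≤ 17 * Γ.card / η := by
    have h1 := (Nat.ceil_lt_add_one (by positivity : 0 ≤ 16 * (Γ.card : ℝ) / η)).le
    refine h1.trans ?_
    have : 1 ≤ (Γ.card : ℝ) / η := by rw [le_div_iff₀ hη]; linarith
    have e : 17 * (Γ.card : ℝ) / η = 16 * (Γ.card : ℝ) / η + Γ.card / η := by ring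
    linarith
  have hJ0 : 0 < J := by
    have : (0 : ℝ) < J := lt_of_lt_of_le (by positivity) hJ1
    exact_mod_cast this
  have hJr : (0 : ℝ) < J := by exact_mod_cast hJ0
  have hlog : η / 8 ≤ Real.log (1 + η / 4) := by
    refine le_trans ?_ (Real.one_sub_inv_le_log_of_pos (by positivity))
    rw [le_sub_iff_add_le, ← le_sub_iff_add_le', inv_le_comm₀ (by positivity) (by linarith),
      inv_le_iff_one_le_mul₀ (by linarith)]
    nlinarith
  obtain ⟨t, ht1, ht2, ht3⟩ := exists_slow_growth μ hΓ (τ := η / 4) hr (by positivity) hJ0 (by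
    calc 2 * (Γ.card : ℝ) = (16 * (Γ.card : ℝ) / η) * (η / 8) := by field_simp; norm_num
      _ ≤ J * Real.log (1 + η / 4) := by gcongr)
  -- A third of the slow-growth gap: `h` descends on the middle third, so a shift by gauge at most
  -- `q` changes `h` only in the thin shell between `t` and `t + 3q`.
  set q : ℝ := r / J / 3 with hq
  have hq0 : 0 < q := by positivity
  have hq3 : r / J = 3 * q := by rw [hq]; ring
  rw [hq3] at ht2 ht3
  set h : G → ℝ := bump hΓ (t + q) (t + 2 * q) with hh
  have hab : t + q < t + 2 * q := by linarith
  have hhc : Continuous h := continuous_bump hΓ _ _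
  have hBm : ∀ s, MeasurableSet (bohrSet (Γ : Set (PontryaginDual G)) s) :=
    fun s => (isClosed_bohrSet _ s).measurableSet
  set I : ℝ := ∫ x, h x ∂μ with hI
  have hI1 : μ.real (bohrSet (Γ : Set (PontryaginDual G)) t) ≤ I :=
    measureReal_le_integral_of_one_le μ (hBm t) hhc (bump_nonneg hΓ _ _) fun x hx =>
      (bump_eq_one hΓ hab (((mem_bohrSet_iff hΓ).1 hx).trans (by linarith))).ge
  have hI0 : 0 < I := (measureReal_bohrSet_pos μ hΓ (by linarith)).trans_le hI1
  refine ⟨fun x => I⁻¹ * h x, by fun_prop, fun x => ?_, fun x => ?_, ?_, fun x hx => ?_,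
    fun γ hγ y hy => ?_⟩
  · exact mul_nonneg (inv_nonneg.2 hI0.le) (bump_nonneg hΓ _ _ x)
  · change I⁻¹ * h x⁻¹ = I⁻¹ * h x
    rw [hh, bump_inv]
  · rw [integral_const_mul, inv_mul_cancel₀ hI0.ne']
  · have := bohrGauge_lt_of_bump_ne_zero hΓ hab (right_ne_zero_of_mul hx)
    linarith
  · have hyq : bohrGauge hΓ y ≤ q := by
      refine hy.trans ?_
      rw [hq, div_div, div_le_div_iff₀ (mul_pos (by norm_num) (by linarith))
        (mul_pos hJr three_pos)]
      rw [le_div_iff₀ hη] at hJ2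
      calc r * η * (J * 3) = r * 3 * (J * η) := by ring
        _ ≤ r * 3 * (17 * Γ.card) := by gcongr
        _ = _ := by ring
    have hdiff : ∀ x, |h (y⁻¹ * x) - h x| ≤ (bohrSet (Γ : Set (PontryaginDual G)) (t + 3 * q) \
        bohrSet (Γ : Set (PontryaginDual G)) t).indicator 1 x := by
      intro x
      have h1 := bohrGauge_mul_le hΓ y⁻¹ x
      have h2 := bohrGauge_mul_le hΓ y (y⁻¹ * x)
      rw [mul_inv_cancel_left] at h2
      rw [bohrGauge_inv] at h1
      rcases le_or_gt (bohrGauge hΓ x) t with hx | hx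
      · rw [hh, bump_eq_one hΓ hab (by linarith), bump_eq_one hΓ hab (by linarith), sub_self,
          abs_zero]
        exact Set.indicator_nonneg (fun _ _ => zero_le_one) _
      rcases le_or_gt (bohrGauge hΓ x) (t + 3 * q) with hx' | hx'
      · have hmem : x ∈ bohrSet (Γ : Set (PontryaginDual G)) (t + 3 * q) \
            bohrSet (Γ : Set (PontryaginDual G)) t :=
          ⟨(mem_bohrSet_iff hΓ).2 hx',
            fun hc => absurd ((mem_bohrSet_iff hΓ).1 hc) (not_le.2 hx)⟩
        rw [Set.indicator_of_mem hmem, Pi.one_apply, abs_le]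
        have b1 := bump_nonneg hΓ (t + q) (t + 2 * q) x
        have b2 := bump_le_one hΓ (t + q) (t + 2 * q) x
        have b3 := bump_nonneg hΓ (t + q) (t + 2 * q) (y⁻¹ * x)
        have b4 := bump_le_one hΓ (t + q) (t + 2 * q) (y⁻¹ * x)
        constructor <;> linarith
      · rw [hh, bump_eq_zero hΓ hab (by linarith), bump_eq_zero hΓ hab (by linarith), sub_self,
          abs_zero]
        exact Set.indicator_nonneg (fun _ _ => zero_le_one) _
    have hγc := continuous_coe_char γ
    -- A shift multiplies the transform by `γ y`, so the shell's measure, at most `η/4` of the mass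
    -- of `h`, bounds this product. Dividing by `|ĥ(γ)| > I/2` leaves `η/2`.
    have e1 : ((γ y : ℂ) - 1) * charInt μ h γ
        = ∫ x, ((h (y⁻¹ * x) : ℂ) - (h x : ℂ)) * (γ x : ℂ) ∂μ := by
      simp only [sub_mul]
      rw [integral_sub, charInt_translate, one_mul, charInt]
      · exact Continuous.integrable_of_compactSpace μ (by fun_prop)
      · exact Continuous.integrable_of_compactSpace μ (by fun_prop)
    have e2 : ‖((γ y : ℂ) - 1) * charInt μ h γ‖ ≤ η / 4 * I := by
      rw [e1]
      have hm := (hBm (t + 3 * q)).diff (hBm t)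
      refine (norm_integral_le_of_norm_le ((integrable_const (1 : ℝ)).indicator hm)
        (ae_of_all _ fun x => ?_)).trans ?_
      · rw [norm_mul, Circle.norm_coe, mul_one, ← Complex.ofReal_sub, Complex.norm_real]
        exact hdiff x
      · have e3 := integral_indicator_one (μ := μ) hm
        refine e3.le.trans ?_
        rw [measureReal_sdiff (bohrSet_mono _ (by linarith)) (hBm t)]
        have : η / 4 * μ.real (bohrSet (Γ : Set (PontryaginDual G)) t) ≤ η / 4 * I := by gcongr
        linarith
    have e4 : charInt μ (fun x => I⁻¹ * h x) γ = (I : ℂ)⁻¹ * charInt μ h γ := by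
      simp only [charInt, Complex.ofReal_mul, Complex.ofReal_inv, mul_assoc]
      rw [integral_const_mul]
    rw [e4, norm_mul, norm_inv, Complex.norm_real, Real.norm_of_nonneg hI0.le,
      inv_mul_eq_div, lt_div_iff₀ hI0] at hγ
    rw [norm_mul] at e2
    rw [norm_sub_rev]
    have h5 : ‖(γ y : ℂ) - 1‖ * (1 / 2 * I) ≤ η / 4 * I :=
      (mul_le_mul_of_nonneg_left hγ.le (norm_nonneg _)).trans e2
    have h6 : ‖(γ y : ℂ) - 1‖ * (1 / 2) ≤ η / 4 := by
      refine le_of_mul_le_mul_right ?_ hI0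
      linarith
    linarith

end Convolution

/-! ### Riesz products relative to a kernel. -/

section Riesz

variable {G : Type*} [CommGroup G] [TopologicalSpace G] [IsTopologicalGroup G]
  [CompactSpace G] [T2Space G] [MeasurableSpace G] [BorelSpace G]
  (μ : Measure G) [IsHaarMeasure μ] [IsProbabilityMeasure μ]
  {ι : Type*} [Fintype ι] [DecidableEq ι] (l : ι → PontryaginDual G)

/-- The letters of the words `λ^m`, `m ∈ {-1, 0, 1}^ι`. -/
def letters : Finset ℤ := {-1, 0, 1}

/-- The set of exponent vectors `{-1, 0, 1}^ι`. -/
def words (ι : Type*) [Fintype ι] [DecidableEq ι] : Finset (ι → ℤ) :=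
  Fintype.piFinset fun _ => letters

/-- The weight `1` at `0` and `1/2` at `±1`. -/
def letterWeight (j : ℤ) : ℝ := if j = 0 then 1 else 1 / 2

def wordWeight (m : ι → ℤ) : ℝ := ∏ i, letterWeight (m i)

def wordChar (m : ι → ℤ) : PontryaginDual G := ∏ i, l i ^ m i

theorem sum_letters {M : Type*} [AddCommMonoid M] (g : ℤ → M) :
    ∑ j ∈ letters, g j = g (-1) + (g 0 + g 1) := by
  rw [letters, Finset.sum_insert (by decide), Finset.sum_insert (by decide),
    Finset.sum_singleton]

theorem letterWeight_nonneg (j : ℤ) : 0 ≤ letterWeight j := by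
  unfold letterWeight; split_ifs <;> norm_num

theorem wordWeight_nonneg (m : ι → ℤ) : 0 ≤ wordWeight m :=
  Finset.prod_nonneg fun _ _ => letterWeight_nonneg _

theorem sum_wordWeight : ∑ m ∈ words ι, wordWeight m = 2 ^ Fintype.card ι := by
  unfold words wordWeight
  rw [Finset.sum_prod_piFinset letters fun (_ : ι) j => letterWeight j, sum_letters]
  norm_num [letterWeight]

theorem zero_mem_words : (0 : ι → ℤ) ∈ words ι :=
  Fintype.mem_piFinset.2 fun _ => by simp [letters]

theorem coe_wordChar (m : ι → ℤ) (x : G) :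
    (wordChar l m x : ℂ) = ∏ i, ((l i ^ m i) x : ℂ) := by
  let φ : PontryaginDual G →* ℂ :=
    { toFun := fun γ => (γ x : ℂ), map_one' := rfl, map_mul' := fun γ χ => mul_char_apply γ χ x }
  exact map_prod φ _ _

theorem wordChar_zero : wordChar l 0 = 1 := by simp [wordChar]

/-- The expansion of a product of trigonometric polynomials of degree one. -/
theorem prod_eq_sum_words (a : ι → ℤ → ℂ) (x : G) :
    ∏ i, ∑ j ∈ letters, a i j * ((l i ^ j) x : ℂ)
      = ∑ m ∈ words ι, (∏ i, a i (m i)) * (wordChar l m x : ℂ) := by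
  unfold words
  rw [← Finset.sum_prod_piFinset letters fun i j => a i j * ((l i ^ j) x : ℂ)]
  refine Finset.sum_congr rfl fun m _ => ?_
  rw [coe_wordChar, Finset.prod_mul_distrib]

theorem integral_mul_prod_letters {u : G → ℝ} (hu : Continuous u) (γ : PontryaginDual G)
    (a : ι → ℤ → ℂ) :
    ∫ x, (u x : ℂ) * (∏ i, ∑ j ∈ letters, a i j * ((l i ^ j) x : ℂ)) * (γ x : ℂ) ∂μ
      = ∑ m ∈ words ι, (∏ i, a i (m i)) * charInt μ u (γ * wordChar l m) := by
  simp only [prod_eq_sum_words, Finset.mul_sum, Finset.sum_mul]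
  rw [integral_finsetSum]
  · refine Finset.sum_congr rfl fun m _ => ?_
    rw [charInt, ← integral_const_mul]
    refine integral_congr_ae (ae_of_all _ fun x => ?_)
    simp only [mul_char_apply]
    ring
  · intro m _
    have h1 := continuous_coe_char γ
    have h2 := continuous_coe_char (wordChar l m)
    exact Continuous.integrable_of_compactSpace μ (by fun_prop)

theorem sum_letterWeight_mul_char (γ : PontryaginDual G) (x : G) :
    ∑ j ∈ letters, (letterWeight j : ℂ) * ((γ ^ j) x : ℂ)
      = ((1 + (γ x : ℂ).re : ℝ) : ℂ) := by
  rw [sum_letters, zpow_neg_one, zpow_zero, zpow_one, inv_char_apply, Complex.ofReal_add,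
    Complex.re_eq_add_conj]
  simp only [letterWeight, PontryaginDual.one_apply, Circle.coe_one]
  norm_num
  ring

theorem one_add_re_nonneg (z : Circle) : 0 ≤ 1 + (z : ℂ).re := by
  have h := (abs_le.1 ((Complex.abs_re_le_norm (z : ℂ)).trans (Circle.norm_coe z).le)).1
  linarith

/-- A nonnegative kernel with nonnegative transform, small at the nonzero words, bounds the
weighted sum of its transform over any translate of the words. -/
theorem sum_wordWeight_mul_le {K : G → ℝ} (hK : Continuous K) (hK0 : ∀ x, 0 ≤ K x)
    (hK1 : ∫ x, K x ∂μ = 1) {θ : ℝ} (hθ : θ * 2 ^ Fintype.card ι ≤ 1) (hθ0 : 0 ≤ θ)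
    (hsmall : ∀ m ∈ words ι, m ≠ 0 → (charInt μ K (wordChar l m)).re ≤ θ)
    (γ : PontryaginDual G) :
    ∑ m ∈ words ι, wordWeight m * (charInt μ K (γ * wordChar l m)).re ≤ 2 := by
  have hre : ∀ γ : PontryaginDual G,
      ∑ m ∈ words ι, wordWeight m * (charInt μ K (γ * wordChar l m)).re
        = (∫ x, ((K x * ∏ i, (1 + (l i x : ℂ).re) : ℝ) : ℂ) * (γ x : ℂ) ∂μ).re := by
    intro γ
    have h := integral_mul_prod_letters μ l hK γ fun _ j => (letterWeight j : ℂ)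
    simp only [sum_letterWeight_mul_char] at h
    have e : (∫ x, ((K x * ∏ i, (1 + (l i x : ℂ).re) : ℝ) : ℂ) * (γ x : ℂ) ∂μ)
        = ∫ x, (K x : ℂ) * (∏ i, ((1 + (l i x : ℂ).re : ℝ) : ℂ)) * (γ x : ℂ) ∂μ := by
      simp only [Complex.ofReal_mul, Complex.ofReal_prod]
    rw [e, h, Complex.re_sum]
    refine Finset.sum_congr rfl fun m _ => ?_
    rw [wordWeight, ← Complex.ofReal_prod, Complex.re_ofReal_mul]
  set P : G → ℝ := fun x => K x * ∏ i, (1 + (l i x : ℂ).re) with hP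
  have hPc : Continuous P := by
    refine hK.mul (continuous_finsetProd _ fun i _ => ?_)
    have := continuous_coe_char (l i)
    fun_prop
  have hP0 : ∀ x, 0 ≤ P x := fun x =>
    mul_nonneg (hK0 x) (Finset.prod_nonneg fun i _ => one_add_re_nonneg _)
  -- `P ≥ 0`, so its transform is largest at the trivial character. There the empty word contributes
  -- 1 and all other words together at most `θ * 2^|ι| ≤ 1`.
  have h1 : ∑ m ∈ words ι, wordWeight m * (charInt μ K (γ * wordChar l m)).re ≤ ∫ x, P x ∂μ := by
    rw [hre γ]
    exact (Complex.re_le_norm _).trans (norm_charInt_le μ hPc hP0 γ)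
  have h2 : ∫ x, P x ∂μ = ∑ m ∈ words ι, wordWeight m * (charInt μ K (wordChar l m)).re := by
    have h3 := hre 1
    simp only [one_mul] at h3
    rw [h3]
    exact (congrArg Complex.re (charInt_one μ P)).symm
  have h0 : (charInt μ K (wordChar l 0)).re = 1 := by
    rw [wordChar_zero, charInt_one, hK1]; rfl
  have hw0 : wordWeight (0 : ι → ℤ) = 1 := by simp [wordWeight, letterWeight]
  have h5 := Finset.add_sum_erase (words ι)
    (fun m => wordWeight m * (charInt μ K (wordChar l m)).re) zero_mem_words
  simp only [h0, hw0, mul_one] at h5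
  have h4 : ∑ m ∈ (words ι).erase 0, wordWeight m * (charInt μ K (wordChar l m)).re ≤ 1 :=
    calc _ ≤ ∑ m ∈ (words ι).erase 0, wordWeight m * θ := by
          refine Finset.sum_le_sum fun m hm => ?_
          exact mul_le_mul_of_nonneg_left
            (hsmall m (Finset.mem_of_mem_erase hm) (Finset.ne_of_mem_erase hm))
            (wordWeight_nonneg m)
      _ ≤ ∑ m ∈ words ι, wordWeight m * θ :=
          Finset.sum_le_sum_of_subset_of_nonneg (Finset.erase_subset _ _) fun m _ _ =>
            mul_nonneg (wordWeight_nonneg m) hθ0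
      _ = θ * 2 ^ Fintype.card ι := by rw [← Finset.sum_mul, sum_wordWeight, mul_comm]
      _ ≤ 1 := hθ
  linarith

/-- Coefficients of `1 + z Re(ω χ)` as a combination of `χ⁻¹, 1, χ`. -/
def rieszCoeff (z ω : ℂ) (j : ℤ) : ℂ :=
  if j = 0 then 1 else if j = 1 then z * ω / 2 else z * (starRingEnd ℂ) ω / 2

theorem sum_rieszCoeff (z ω : ℂ) (γ : PontryaginDual G) (x : G) :
    ∑ j ∈ letters, rieszCoeff z ω j * ((γ ^ j) x : ℂ) = 1 + z * ((ω * (γ x : ℂ)).re : ℂ) := by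
  rw [sum_letters, zpow_neg_one, zpow_zero, zpow_one, inv_char_apply, Complex.re_eq_add_conj,
    map_mul]
  simp only [rieszCoeff, PontryaginDual.one_apply, Circle.coe_one]
  norm_num
  ring

theorem norm_rieszCoeff_le {z ω : ℂ} (hz : ‖z‖ ≤ 1) (hω : ‖ω‖ ≤ 1) (j : ℤ) :
    ‖rieszCoeff z ω j‖ ≤ letterWeight j := by
  unfold rieszCoeff letterWeight
  have : ‖z‖ * ‖ω‖ ≤ 1 := mul_le_one₀ hz (norm_nonneg _) hω
  split_ifs
  · simp
  · rw [norm_div, norm_mul, Complex.norm_two]; linarith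
  · rw [norm_div, norm_mul, Complex.norm_two, RCLike.norm_conj]; linarith

/-- The generalised Riesz product `∏ (1 + z Re(ω_i λ_i))`. -/
def rieszProd (ω : ι → ℂ) (z : ℂ) (x : G) : ℂ := ∏ i, (1 + z * ((ω i * (l i x : ℂ)).re : ℂ))

theorem continuous_re_mul_char (ω : ℂ) (γ : PontryaginDual G) :
    Continuous fun x => (ω * (γ x : ℂ)).re := by
  have := continuous_coe_char γ
  fun_prop

theorem continuous_rieszProd (ω : ι → ℂ) (z : ℂ) : Continuous (rieszProd l ω z) :=
  continuous_finsetProd _ fun i _ => by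
    have := continuous_re_mul_char (ω i) (l i)
    fun_prop

theorem abs_re_mul_char_le {ω : ℂ} (hω : ‖ω‖ ≤ 1) (z : Circle) : |(ω * (z : ℂ)).re| ≤ 1 := by
  refine (Complex.abs_re_le_norm _).trans ?_
  rwa [norm_mul, Circle.norm_coe, mul_one]

theorem rieszProd_ofReal (ω : ι → ℂ) (t : ℝ) (x : G) :
    rieszProd l ω t x = ((∏ i, (1 + t * (ω i * (l i x : ℂ)).re) : ℝ) : ℂ) := by
  simp [rieszProd]

theorem prod_one_add_nonneg {ω : ι → ℂ} (hω : ∀ i, ‖ω i‖ ≤ 1) {t : ℝ} (ht : |t| ≤ 1) (x : G) :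
    0 ≤ ∏ i, (1 + t * (ω i * (l i x : ℂ)).re) := by
  refine Finset.prod_nonneg fun i _ => ?_
  have h1 : |t * (ω i * (l i x : ℂ)).re| ≤ 1 := by
    rw [abs_mul]
    exact mul_le_one₀ ht (abs_nonneg _) (abs_re_mul_char_le (hω i) _)
  linarith [(abs_le.1 h1).1]

variable {u K : G → ℝ} {M θ : ℝ}

/-- Positivity is lost for complex `z`, but the expansion is dominated term by term by `M` times
that of `K ∏(1 + Re λ_i)`: coefficients by `letterWeight`, transforms by `huK`. -/
theorem norm_integral_rieszProd_le (hu : Continuous u) (hK : Continuous K) (hK0 : ∀ x, 0 ≤ K x)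
    (hK1 : ∫ x, K x ∂μ = 1) (hθ : θ * 2 ^ Fintype.card ι ≤ 1) (hθ0 : 0 ≤ θ)
    (hsmall : ∀ m ∈ words ι, m ≠ 0 → (charInt μ K (wordChar l m)).re ≤ θ) (hM : 0 ≤ M)
    (huK : ∀ γ, ‖charInt μ u γ‖ ≤ M * (charInt μ K γ).re)
    {ω : ι → ℂ} (hω : ∀ i, ‖ω i‖ ≤ 1) {z : ℂ} (hz : ‖z‖ ≤ 1) (γ : PontryaginDual G) :
    ‖∫ x, (u x : ℂ) * rieszProd l ω z x * (γ x : ℂ) ∂μ‖ ≤ 2 * M := by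
  have h := integral_mul_prod_letters μ l hu γ fun i j => rieszCoeff z (ω i) j
  simp only [sum_rieszCoeff] at h
  change ∫ x, (u x : ℂ) * rieszProd l ω z x * (γ x : ℂ) ∂μ = _ at h
  rw [h]
  calc _ ≤ ∑ m ∈ words ι, wordWeight m * (M * (charInt μ K (γ * wordChar l m)).re) := by
        refine norm_sum_le_of_le _ fun m _ => ?_
        rw [norm_mul, norm_prod]
        refine mul_le_mul ?_ (huK _) (norm_nonneg _) (wordWeight_nonneg m)
        exact Finset.prod_le_prod (fun _ _ => norm_nonneg _) fun i _ =>
          norm_rieszCoeff_le hz (hω i) _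
    _ = M * ∑ m ∈ words ι, wordWeight m * (charInt μ K (γ * wordChar l m)).re := by
        rw [Finset.mul_sum]
        exact Finset.sum_congr rfl fun m _ => by ring
    _ ≤ M * 2 := by
        gcongr
        exact sum_wordWeight_mul_le μ l hK hK0 hK1 hθ hθ0 hsmall γ
    _ = _ := by ring

/-- Expansion of `∫ f u ∏ (1 + z Re(ω_i λ_i))` in powers of `z`. -/
theorem integral_mul_rieszProd_eq {f : G → ℂ} (hf : Integrable f μ) (hu : Continuous u)
    (ω : ι → ℂ) (z : ℂ) :
    ∫ x, f x * ((u x : ℂ) * rieszProd l ω z x) ∂μ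
      = ∑ s : Finset ι, z ^ s.card *
          ∫ x, f x * ((u x : ℂ) * ∏ i ∈ s, ((ω i * (l i x : ℂ)).re : ℂ)) ∂μ := by
  have e : ∀ x, f x * ((u x : ℂ) * rieszProd l ω z x)
      = ∑ s : Finset ι, z ^ s.card *
          (f x * ((u x : ℂ) * ∏ i ∈ s, ((ω i * (l i x : ℂ)).re : ℂ))) := by
    intro x
    rw [rieszProd, Finset.prod_one_add, Finset.powerset_univ, Finset.mul_sum, Finset.mul_sum]
    refine Finset.sum_congr rfl fun s _ => ?_
    rw [Finset.prod_mul_distrib, Finset.prod_const]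
    ring
  simp only [e]
  rw [integral_finsetSum]
  · exact Finset.sum_congr rfl fun s _ => integral_const_mul _ _
  · intro s _
    refine (integrable_mul_continuous μ hf ?_).const_mul _
    refine (by fun_prop : Continuous fun x => (u x : ℂ)).mul
      (continuous_finsetProd _ fun i _ => ?_)
    have := continuous_re_mul_char (ω i) (l i)
    fun_prop

theorem deriv_sum_pow_card (q : Finset ι → ℂ) :
    deriv (fun z : ℂ => ∑ s : Finset ι, z ^ s.card * q s) 0 = ∑ i, q {i} := by
  have h1 : ∀ s : Finset ι, HasDerivAt (fun z : ℂ => z ^ s.card * q s)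
      (if s.card = 1 then q s else 0) 0 := by
    intro s
    have h := (hasDerivAt_pow s.card (0 : ℂ)).mul_const (q s)
    refine h.congr_deriv ?_
    rcases hn : s.card with _ | _ | n
    · simp
    · simp
    · simp
  rw [(HasDerivAt.fun_sum fun s _ => h1 s).deriv, ← Finset.sum_filter]
  refine (Finset.sum_nbij (s := Finset.univ) (fun i : ι => ({i} : Finset ι)) (fun i _ => by simp) (fun i _ j _ h => by simpa using h)
    (fun s hs => ?_) fun _ _ => rfl).symm
  obtain ⟨i, rfl⟩ := Finset.card_eq_one.1 (Finset.mem_filter.1 hs).2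
  exact ⟨i, by simp, rfl⟩

/-- The sum is the linear coefficient of `Q(z) = ∫ f u ∏(1 + z Re(ω_i λ_i))`. For real `z` the
product is nonnegative, so its `L¹` norm against `u` is its mean and `|Q| ≤ 2MS`; on the disc the
`A(G)` norm enters, and `norm_deriv_zero_le` makes it logarithmic. -/
theorem norm_integral_mul_sum_re_le {f : G → ℂ} (hf : MemA μ f) (hu : Continuous u)
    (hu0 : ∀ x, 0 ≤ u x) {S A : ℝ} (hS : 0 < S) (hfS : ∀ᵐ x ∂μ, u x ≠ 0 → ‖f x‖ ≤ S)
    (hA : 1 ≤ A) (hfA : normA μ f ≤ S * A)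
    (hK : Continuous K) (hK0 : ∀ x, 0 ≤ K x)
    (hK1 : ∫ x, K x ∂μ = 1) (hθ : θ * 2 ^ Fintype.card ι ≤ 1) (hθ0 : 0 ≤ θ)
    (hsmall : ∀ m ∈ words ι, m ≠ 0 → (charInt μ K (wordChar l m)).re ≤ θ) (hM : 0 < M)
    (huK : ∀ γ, ‖charInt μ u γ‖ ≤ M * (charInt μ K γ).re)
    {ω : ι → ℂ} (hω : ∀ i, ‖ω i‖ ≤ 1) :
    ‖∑ i, ∫ x, f x * ((u x : ℂ) * ((ω i * (l i x : ℂ)).re : ℂ)) ∂μ‖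
      ≤ 4 * (2 * M * S * (1 + Real.log A)) := by
  set Q : ℂ → ℂ := fun z => ∑ s : Finset ι, z ^ s.card *
    ∫ x, f x * ((u x : ℂ) * ∏ i ∈ s, ((ω i * (l i x : ℂ)).re : ℂ)) ∂μ with hQ
  have hQe : ∀ z, Q z = ∫ x, f x * ((u x : ℂ) * rieszProd l ω z x) ∂μ := fun z =>
    (integral_mul_rieszProd_eq μ l hf.1 hu ω z).symm
  have hd : deriv Q 0 = ∑ i, ∫ x, f x * ((u x : ℂ) * ((ω i * (l i x : ℂ)).re : ℂ)) ∂μ := by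
    rw [hQ, deriv_sum_pow_card]
    simp only [Finset.prod_singleton]
  have huc : Continuous fun x => (u x : ℂ) := by fun_prop
  have hbound : ∀ z : ℂ, ‖z‖ ≤ 1 → ∀ γ : PontryaginDual G,
      ‖∫ x, (u x : ℂ) * rieszProd l ω z x * (γ x : ℂ) ∂μ‖ ≤ 2 * M := fun z hz γ =>
    norm_integral_rieszProd_le μ l hu hK hK0 hK1 hθ hθ0 hsmall hM.le huK hω hz γ
  rw [← hd]
  refine norm_deriv_zero_le (by fun_prop) (by positivity) hA (fun t ht => ?_) fun z hz => ?_
  · set p : G → ℝ := fun x => u x * ∏ i, (1 + t * (ω i * (l i x : ℂ)).re) with hp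
    have hpc : Continuous p := by
      refine hu.mul (continuous_finsetProd _ fun i _ => ?_)
      have := continuous_re_mul_char (ω i) (l i)
      fun_prop
    have hp0 : ∀ x, 0 ≤ p x := fun x => mul_nonneg (hu0 x) (prod_one_add_nonneg l hω ht x)
    have hpe : ∀ x, (u x : ℂ) * rieszProd l ω t x = (p x : ℂ) := fun x => by
      rw [rieszProd_ofReal, hp, Complex.ofReal_mul]
    have h1 : ∫ x, p x ∂μ ≤ 2 * M := by
      have h2 := hbound t (by rwa [Complex.norm_real]) 1
      simp only [hpe] at h2
      change ‖charInt μ p 1‖ ≤ _ at h2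
      rw [charInt_one, Complex.norm_real] at h2
      exact (le_abs_self _).trans h2
    rw [hQe]
    simp only [hpe]
    calc _ ≤ ∫ x, S * p x ∂μ := by
          refine norm_integral_le_of_norm_le
            ((Continuous.integrable_of_compactSpace μ hpc).const_mul S) ?_
          filter_upwards [hfS] with x hx
          rw [norm_mul, Complex.norm_real, Real.norm_of_nonneg (hp0 x)]
          by_cases h0 : u x = 0
          · simp [hp, h0]
          · exact mul_le_mul_of_nonneg_right (hx h0) (hp0 x)
      _ = S * ∫ x, p x ∂μ := integral_const_mul _ _
      _ ≤ S * (2 * M) := by gcongr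
      _ = _ := by ring
  · rw [hQe]
    refine (norm_integral_mul_le_normA μ hf (huc.mul (continuous_rieszProd l ω z))
      (hbound z hz)).trans ?_
    calc normA μ f * (2 * M) ≤ S * A * (2 * M) := by gcongr
      _ = _ := by ring

/-- The `ℓ¹` bound for Fourier coefficients of `f u` along a dissociated family. -/
theorem sum_norm_integral_le {f : G → ℂ} (hf : MemA μ f) (hu : Continuous u)
    (hu0 : ∀ x, 0 ≤ u x) {S A : ℝ} (hS : 0 < S) (hfS : ∀ᵐ x ∂μ, u x ≠ 0 → ‖f x‖ ≤ S)
    (hA : 1 ≤ A) (hfA : normA μ f ≤ S * A)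
    (hK : Continuous K) (hK0 : ∀ x, 0 ≤ K x)
    (hK1 : ∫ x, K x ∂μ = 1) (hθ : θ * 2 ^ Fintype.card ι ≤ 1) (hθ0 : 0 ≤ θ)
    (hsmall : ∀ m ∈ words ι, m ≠ 0 → (charInt μ K (wordChar l m)).re ≤ θ) (hM : 0 < M)
    (huK : ∀ γ, ‖charInt μ u γ‖ ≤ M * (charInt μ K γ).re) :
    ∑ i, ‖fourier μ (fun x => f x * (u x : ℂ)) (l i)‖ ≤ 16 * (M * S * (1 + Real.log A)) := by
  set c : ι → ℂ := fun i => fourier μ (fun x => f x * (u x : ℂ)) (l i) with hc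
  have hω : ∀ i, ∃ w : ℂ, ‖w‖ = 1 ∧ w * c i = (‖c i‖ : ℂ) := by
    intro i
    by_cases h : c i = 0
    · exact ⟨1, by simp, by simp [h]⟩
    · have h' : (‖c i‖ : ℂ) ≠ 0 := by exact_mod_cast (norm_pos_iff.2 h).ne'
      refine ⟨(‖c i‖ : ℂ) / c i, ?_, div_mul_cancel₀ _ h⟩
      rw [norm_div, Complex.norm_real, norm_norm, div_self (norm_pos_iff.2 h).ne']
  choose w hw1 hw2 using hω
  have huc : Continuous fun x => (u x : ℂ) := by fun_prop
  have hint : ∀ (v : ℂ) (i : ι),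
      Integrable (fun x => f x * ((u x : ℂ) * ((v * (l i x : ℂ)).re : ℂ))) μ := fun v i => by
    refine integrable_mul_continuous μ hf.1 (huc.mul ?_)
    have := continuous_re_mul_char v (l i)
    fun_prop
  -- With `a = conj(w) λ`, use `conj a = Re a + i Re(i a)`. The real-part bound is thus applied
  -- twice, turning 8 into 16.
  have key : ∀ i, (‖c i‖ : ℂ)
      = ∫ x, f x * ((u x : ℂ) * ((((starRingEnd ℂ) (w i)) * (l i x : ℂ)).re : ℂ)) ∂μ
        + Complex.I *
          ∫ x, f x * ((u x : ℂ) * (((Complex.I * (starRingEnd ℂ) (w i)) * (l i x : ℂ)).re : ℂ)) ∂μ := by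
    intro i
    rw [← hw2 i, hc]
    simp only [fourier]
    rw [← integral_const_mul, ← integral_const_mul, ← integral_add (hint _ i)
      ((hint _ i).const_mul _)]
    refine integral_congr_ae (ae_of_all _ fun x => ?_)
    simp only [Complex.re_eq_add_conj, map_mul, Complex.conj_conj, Complex.conj_I]
    ring_nf
    rw [Complex.I_sq]
    ring
  have hw : ∀ i, ‖(starRingEnd ℂ) (w i)‖ ≤ 1 := fun i => by rw [RCLike.norm_conj, hw1]
  have h1 := norm_integral_mul_sum_re_le μ l hf hu hu0 hS hfS hA hfA hK hK0 hK1 hθ hθ0 hsmall hM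
    huK hw
  have h2 := norm_integral_mul_sum_re_le μ l hf hu hu0 hS hfS hA hfA hK hK0 hK1 hθ hθ0 hsmall hM
    huK (ω := fun i => Complex.I * (starRingEnd ℂ) (w i)) fun i => by
      rw [norm_mul, Complex.norm_I, one_mul]; exact hw i
  have h3 : ((∑ i, ‖c i‖ : ℝ) : ℂ)
      = (∑ i, ∫ x, f x * ((u x : ℂ) * ((((starRingEnd ℂ) (w i)) * (l i x : ℂ)).re : ℂ)) ∂μ)
        + Complex.I * ∑ i, ∫ x, f x *
          ((u x : ℂ) * (((Complex.I * (starRingEnd ℂ) (w i)) * (l i x : ℂ)).re : ℂ)) ∂μ := by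
    rw [Complex.ofReal_sum, Finset.sum_congr rfl fun i _ => key i, Finset.sum_add_distrib,
      ← Finset.mul_sum]
  have h4 := congrArg norm h3
  rw [Complex.norm_real, Real.norm_of_nonneg (Finset.sum_nonneg fun i _ => norm_nonneg _)] at h4
  rw [h4]
  refine (norm_add_le _ _).trans ?_
  rw [norm_mul, Complex.norm_I, one_mul]
  linarith

end Riesz

/-! ### Maximal dissociated sets. -/

section Dissociated

variable {D : Type*} [CommGroup D]

/-- No nonzero word in `Λ` with exponents in `{-1, 0, 1}` lies in `T`. -/
def IsDissociated (T : Set D) (Λ : Finset D) : Prop :=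
  ∀ m : D → ℤ, (∀ a, m a ∈ letters) → (∃ a ∈ Λ, m a ≠ 0) → ∏ a ∈ Λ, a ^ m a ∉ T

theorem mem_letters {j : ℤ} : j ∈ letters ↔ j = -1 ∨ j = 0 ∨ j = 1 := by simp [letters]

theorem neg_mem_letters {j : ℤ} (h : j ∈ letters) : -j ∈ letters := by
  rw [mem_letters] at h ⊢; omega

/-- If dissociated subsets of `S` of size at most `N` have size less than `N`, then `S` lies in
`T` times the span of a dissociated subset. -/
theorem exists_isDissociated_span (T S : Set D) (h1 : 1 ∈ T) (hinv : ∀ a ∈ T, a⁻¹ ∈ T) (N : ℕ)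
    (hN : ∀ Λ : Finset D, (Λ : Set D) ⊆ S → IsDissociated T Λ → Λ.card ≤ N → Λ.card < N) :
    ∃ Λ : Finset D, Λ.card < N ∧
      ∀ g ∈ S, ∃ m : D → ℤ, (∀ a, m a ∈ letters) ∧ g * ∏ a ∈ Λ, a ^ m a ∈ T := by
  classical
  let P : ℕ → Prop := fun n =>
    ∃ Λ : Finset D, (Λ : Set D) ⊆ S ∧ IsDissociated T Λ ∧ Λ.card = n
  have hP0 : P 0 := ⟨∅, by simp, fun m _ ⟨a, ha, _⟩ => absurd ha (Finset.notMem_empty a), rfl⟩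
  -- Maximality is only among sizes up to `N`, since the size bound is only available there. As the
  -- size found is below `N`, enlarging by one element stays in range.
  obtain ⟨Λ, hΛS, hΛd, hΛc⟩ := Nat.findGreatest_spec (P := P) (Nat.zero_le N) hP0
  have hlt : Λ.card < N := hN Λ hΛS hΛd (hΛc ▸ Nat.findGreatest_le N)
  refine ⟨Λ, hlt, fun g hg => ?_⟩
  by_cases hgΛ : g ∈ Λ
  · refine ⟨fun a => if a = g then -1 else 0, fun a => ?_, ?_⟩
    · rw [mem_letters]; beta_reduce; split_ifs <;> simp
    · have e : ∏ a ∈ Λ, a ^ (if a = g then (-1 : ℤ) else 0) = g⁻¹ := by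
        rw [Finset.prod_eq_single_of_mem g hgΛ fun a _ hne => by simp [hne]]
        simp
      rw [e, mul_inv_cancel]
      exact h1
  · have hnd : ¬ IsDissociated T (insert g Λ) := by
      intro hd
      have hc : (insert g Λ).card = Λ.card + 1 := Finset.card_insert_of_notMem hgΛ
      have h2 : P (Λ.card + 1) := ⟨insert g Λ, by
        rw [Finset.coe_insert]; exact Set.insert_subset hg hΛS, hd, hc⟩
      have h3 := Nat.le_findGreatest (P := P) (n := N) hlt h2
      omega
    unfold IsDissociated at hnd
    push Not at hnd
    -- The offending word must involve `g`, with exponent 1 or -1; in the latter case it is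
    -- inverted.
    obtain ⟨m, hm, ⟨a, ha, ha0⟩, hmT⟩ := hnd
    rw [Finset.prod_insert hgΛ] at hmT
    rcases mem_letters.1 (hm g) with h | h | h
    · refine ⟨fun a => -m a, fun a => neg_mem_letters (hm a), ?_⟩
      have := hinv _ hmT
      rw [h, zpow_neg_one, mul_inv, inv_inv] at this
      simpa only [zpow_neg, Finset.prod_inv_distrib] using this
    · rw [h, zpow_zero, one_mul] at hmT
      refine absurd hmT (hΛd m hm ⟨a, ?_, ha0⟩)
      rcases Finset.mem_insert.1 ha with rfl | h'
      · exact absurd h ha0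
      · exact h'
    · rw [h, zpow_one] at hmT
      exact ⟨m, hm, hmT⟩

end Dissociated

theorem circleVal_prod_zpow_le {ι : Type*} (s : Finset ι) (z : ι → Circle) (m : ι → ℤ)
    (hm : ∀ i, m i ∈ letters) {t : ℝ} (hz : ∀ i ∈ s, circleVal (z i) ≤ t) :
    circleVal (∏ i ∈ s, z i ^ m i) ≤ s.card * t := by
  classical
  induction s using Finset.induction_on with
  | empty => simp [circleVal_one]
  | insert i s hi ih =>
    rw [Finset.prod_insert hi, Finset.card_insert_of_notMem hi]
    have h1 := ih fun j hj => hz j (Finset.mem_insert_of_mem hj)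
    have h2 := hz i (Finset.mem_insert_self i s)
    have h3 : circleVal (z i ^ m i) ≤ circleVal (z i) := by
      rcases mem_letters.1 (hm i) with h | h | h
      · rw [h, zpow_neg_one, circleVal_inv]
      · rw [h, zpow_zero, circleVal_one]; exact circleVal_nonneg _
      · rw [h, zpow_one]
    have h4 := circleVal_mul_le (z i ^ m i) (∏ i ∈ s, z i ^ m i)
    push_cast
    linarith

/-! ### Smoothing the Bohr cutoff and bounding dissociated spectra. -/

section Main

variable {G : Type*} [CommGroup G] [TopologicalSpace G] [IsTopologicalGroup G]
  [CompactSpace G] [T2Space G] [MeasurableSpace G] [BorelSpace G]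
  (μ : Measure G) [IsHaarMeasure μ] [IsProbabilityMeasure μ]
  {Γ : Finset (PontryaginDual G)} (hΓ : Γ.Nonempty)

theorem norm_charInt_inv (u : G → ℝ) (γ : PontryaginDual G) :
    ‖charInt μ u γ⁻¹‖ = ‖charInt μ u γ‖ := by
  rw [← RCLike.norm_conj (charInt μ u γ), charInt, charInt, ← integral_conj]
  simp only [map_mul, Complex.conj_ofReal, inv_char_apply]

theorem ae_bohrCutoff_iff {δ : ℝ} {p : G → Prop} :
    (∀ᵐ x ∂bohrCutoff μ (Γ : Set (PontryaginDual G)) δ, p x) ↔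
      ∀ᵐ x ∂μ, x ∈ bohrSet (Γ : Set (PontryaginDual G)) δ → p x := by
  rw [bohrCutoff, ProbabilityTheory.cond,
    ae_ennreal_smul_measure_iff (ENNReal.inv_ne_zero.2 (measure_ne_top _ _)),
    ae_restrict_iff' (isClosed_bohrSet _ δ).measurableSet]

/-- Finiteness here ensures that `toReal` in `supNormBohr` loses nothing; the bound also gives `A ≥
1`. -/
theorem supNormBohr_le_normA {δ : ℝ} {f : G → ℂ} (hf : MemA μ f) :
    eLpNorm f ⊤ (bohrCutoff μ (Γ : Set (PontryaginDual G)) δ) ≤ ENNReal.ofReal (normA μ f) := by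
  rw [eLpNorm_exponent_top]
  refine eLpNormEssSup_le_of_ae_bound ?_
  rw [ae_bohrCutoff_iff μ]
  filter_upwards [ae_norm_le_normA μ hf] with x hx _
  exact hx

theorem ae_norm_le_supNormBohr {δ : ℝ} {f : G → ℂ}
    (hf : MemA μ f) : ∀ᵐ x ∂μ, x ∈ bohrSet (Γ : Set (PontryaginDual G)) δ →
      ‖f x‖ ≤ supNormBohr μ (Γ : Set (PontryaginDual G)) δ f := by
  rw [← ae_bohrCutoff_iff μ]
  have hfin := (supNormBohr_le_normA (Γ := Γ) (δ := δ) μ hf).trans_lt ENNReal.ofReal_lt_top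
  filter_upwards [enorm_ae_le_eLpNormEssSup f
    (bohrCutoff μ (Γ : Set (PontryaginDual G)) δ)] with x hx
  rw [← eLpNorm_exponent_top] at hx
  have := ENNReal.toReal_mono hfin.ne hx
  rwa [toReal_enorm] at this

theorem fourier_bohrCutoff (f : G → ℂ) (γ : PontryaginDual G) (δ : ℝ) :
    fourier (bohrCutoff μ (Γ : Set (PontryaginDual G)) δ) f γ
      = ((μ.real (bohrSet (Γ : Set (PontryaginDual G)) δ) : ℝ) : ℂ)⁻¹ *
        ∫ x in bohrSet (Γ : Set (PontryaginDual G)) δ, f x * (starRingEnd ℂ) (γ x : ℂ) ∂μ := by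
  rw [fourier, bohrCutoff, ProbabilityTheory.cond, integral_smul_measure, ENNReal.toReal_inv,
    ← measureReal_def, Complex.real_smul, Complex.ofReal_inv]

/-- Replacing the cutoff on a Bohr set by a nearby smooth one perturbs Fourier coefficients
little. -/
theorem norm_fourier_bohrCutoff_le (hΓ : Γ.Nonempty) {δ τ : ℝ} (hδ : 0 < δ) {f : G → ℂ}
    (hf : MemA μ f) {u : G → ℝ} (hu : Continuous u) (hu1 : ∀ x, u x ≤ 1)
    (husupp : ∀ x, u x ≠ 0 → x ∈ bohrSet (Γ : Set (PontryaginDual G)) δ)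
    (huint : (1 - τ) * μ.real (bohrSet (Γ : Set (PontryaginDual G)) δ) ≤ ∫ x, u x ∂μ)
    (γ : PontryaginDual G) :
    μ.real (bohrSet (Γ : Set (PontryaginDual G)) δ) *
        ‖fourier (bohrCutoff μ (Γ : Set (PontryaginDual G)) δ) f γ‖
      ≤ ‖fourier μ (fun x => f x * (u x : ℂ)) γ‖ +
        supNormBohr μ (Γ : Set (PontryaginDual G)) δ f *
          (τ * μ.real (bohrSet (Γ : Set (PontryaginDual G)) δ)) := by
  set B := bohrSet (Γ : Set (PontryaginDual G)) δ with hB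
  set S := supNormBohr μ (Γ : Set (PontryaginDual G)) δ f with hS
  have hBm : MeasurableSet B := (isClosed_bohrSet _ δ).measurableSet
  have hM : 0 < μ.real B := measureReal_bohrSet_pos μ hΓ hδ
  have hγc : Continuous fun x => (starRingEnd ℂ) (γ x : ℂ) :=
    Complex.continuous_conj.comp (continuous_coe_char γ)
  have hi1 : Integrable (B.indicator fun x => f x * (starRingEnd ℂ) (γ x : ℂ)) μ :=
    (integrable_mul_continuous μ hf.1 hγc).indicator hBm
  have hi2 : Integrable (fun x => f x * (u x : ℂ) * (starRingEnd ℂ) (γ x : ℂ)) μ := by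
    simp only [mul_assoc]
    exact integrable_mul_continuous μ hf.1 (by fun_prop)
  have hi3 : Integrable (B.indicator (1 : G → ℝ)) μ := (integrable_const (1 : ℝ)).indicator hBm
  have hi4 : Integrable u μ := Continuous.integrable_of_compactSpace μ hu
  have hdiff : ‖∫ x, B.indicator (fun x => f x * (starRingEnd ℂ) (γ x : ℂ)) x
        - f x * (u x : ℂ) * (starRingEnd ℂ) (γ x : ℂ) ∂μ‖
      ≤ ∫ x, S * (B.indicator (1 : G → ℝ) x - u x) ∂μ := by
    refine norm_integral_le_of_norm_le ((hi3.sub hi4).const_mul S) ?_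
    filter_upwards [ae_norm_le_supNormBohr μ hf] with x hx
    by_cases hxB : x ∈ B
    · rw [Set.indicator_of_mem hxB, Set.indicator_of_mem hxB, Pi.one_apply]
      have e : f x * (starRingEnd ℂ) (γ x : ℂ) - f x * (u x : ℂ) * (starRingEnd ℂ) (γ x : ℂ)
          = f x * ((1 - u x : ℝ) : ℂ) * (starRingEnd ℂ) (γ x : ℂ) := by
        push_cast; ring
      rw [e, norm_mul, norm_mul, RCLike.norm_conj, Circle.norm_coe, mul_one, Complex.norm_real,
        Real.norm_of_nonneg (sub_nonneg.2 (hu1 x))]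
      exact mul_le_mul_of_nonneg_right (hx hxB) (sub_nonneg.2 (hu1 x))
    · have h0 : u x = 0 := by_contra fun h => hxB (husupp x h)
      simp [Set.indicator_of_notMem hxB, h0]
  rw [integral_sub hi1 hi2, integral_const_mul, integral_sub hi3 hi4, integral_indicator_one hBm,
    integral_indicator hBm] at hdiff
  have hS0 : 0 ≤ S := ENNReal.toReal_nonneg
  have h1 : S * (μ.real B - ∫ x, u x ∂μ) ≤ S * (τ * μ.real B) := by
    gcongr; linarith
  have e1 : μ.real B * ‖fourier (bohrCutoff μ (Γ : Set (PontryaginDual G)) δ) f γ‖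
      = ‖∫ x in B, f x * (starRingEnd ℂ) (γ x : ℂ) ∂μ‖ := by
    rw [fourier_bohrCutoff, norm_mul, norm_inv, Complex.norm_real, Real.norm_of_nonneg hM.le,
      mul_inv_cancel_left₀ hM.ne']
  rw [e1]
  have h2 := norm_sub_norm_le (∫ x in B, f x * (starRingEnd ℂ) (γ x : ℂ) ∂μ)
    (∫ x, f x * (u x : ℂ) * (starRingEnd ℂ) (γ x : ℂ) ∂μ)
  change _ ≤ ‖∫ x, f x * (u x : ℂ) * (starRingEnd ℂ) (γ x : ℂ) ∂μ‖ + _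
  linarith

/-- Smoothing the cutoff of a regular Bohr set by convolution powers of a kernel. -/
theorem exists_smooth_cutoff {cR CR : ℝ} {δ κ : ℝ} (hδ : 0 < δ)
    (hreg : IsRegularBohr cR CR μ Γ δ) (hκ : 0 < κ) (hκR : 2 * κ * Γ.card ≤ cR)
    {k : G → ℝ} (hk : Continuous k) (hk0 : ∀ x, 0 ≤ k x) (hk1 : ∫ x, k x ∂μ = 1) {n : ℕ}
    (hksupp : ∀ x, k x ≠ 0 → n * bohrGauge hΓ x ≤ κ * δ) (hn : 0 < n) :
    ∃ u : G → ℝ, Continuous u ∧ (∀ x, 0 ≤ u x) ∧ (∀ x, u x ≤ 1) ∧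
      (∀ x, u x ≠ 0 → x ∈ bohrSet (Γ : Set (PontryaginDual G)) δ) ∧
      (1 - CR * (2 * κ * Γ.card)) * μ.real (bohrSet (Γ : Set (PontryaginDual G)) δ)
        ≤ ∫ x, u x ∂μ ∧
      ∀ γ, ‖charInt μ u γ‖
        ≤ μ.real (bohrSet (Γ : Set (PontryaginDual G)) δ) * ‖charInt μ k γ‖ ^ n := by
  have hBm : ∀ s, MeasurableSet (bohrSet (Γ : Set (PontryaginDual G)) s) :=
    fun s => (isClosed_bohrSet _ s).measurableSet
  have hM : 0 < μ.real (bohrSet (Γ : Set (PontryaginDual G)) δ) :=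
    measureReal_bohrSet_pos μ hΓ hδ
  have hnr : (0 : ℝ) < n := by exact_mod_cast hn
  have hab : (1 + -(2 * κ)) * δ < (1 - κ) * δ := by nlinarith
  -- The `n` convolutions widen the support by at most `κδ`, which the outer radius `(1 - κ)δ`
  -- leaves room for. Regularity at `-2κ` bounds the mass lost inside.
  set h : G → ℝ := bump hΓ ((1 + -(2 * κ)) * δ) ((1 - κ) * δ) with hh
  have hhc : Continuous h := continuous_bump hΓ _ _
  have hh0 : ∀ x, 0 ≤ h x := bump_nonneg hΓ _ _
  have hh1 : ∀ x, h x ≤ 1 := bump_le_one hΓ _ _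
  have hhs : ∀ x, h x ≠ 0 → bohrGauge hΓ x ≤ (1 - κ) * δ := fun x hx =>
    (bohrGauge_lt_of_bump_ne_zero hΓ hab hx).le
  refine ⟨(conv μ k)^[n] h, continuous_iterate_conv μ hk hhc n, iterate_conv_nonneg μ hk0 hh0 n,
    iterate_conv_le_one μ hk hhc hk0 hk1 hh1 n, fun x hx => ?_, ?_, fun γ => ?_⟩
  · rw [mem_bohrSet_iff hΓ]
    have h1 := bohrGauge_le_of_iterate_conv_ne_zero μ hΓ (r := κ * δ / n) (fun y hy => by
      rw [le_div_iff₀ hnr, mul_comm]; exact hksupp y hy) hhs n hx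
    rw [mul_div_cancel₀ _ hnr.ne'] at h1
    linarith
  · rw [integral_iterate_conv μ hk hhc hk1]
    refine le_trans ?_ (measureReal_le_integral_of_one_le μ (hBm ((1 + -(2 * κ)) * δ)) hhc hh0
      fun x hx => (bump_eq_one hΓ hab ((mem_bohrSet_iff hΓ).1 hx)).ge)
    have h1 := hreg (-(2 * κ)) (by rwa [abs_neg, abs_of_pos (by positivity)])
    rw [abs_neg, abs_of_pos (by positivity : 0 < 2 * κ)] at h1
    have h2 := (abs_le.1 h1).1
    rw [← le_div_iff₀ hM]
    linarith
  · rw [charInt_iterate_conv μ hk hhc, norm_mul, norm_pow, mul_comm]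
    gcongr
    exact (norm_charInt_le μ hhc hh0 γ).trans
      (integral_le_measureReal_of_le_indicator μ (hBm δ) hhc hh1 fun x hx =>
        (mem_bohrSet_iff hΓ).2 ((hhs x hx).trans (by nlinarith)))

/-- The bound for the size of a dissociated set of frequencies where `f u` has large Fourier
coefficients. -/
theorem card_mul_le_of_isDissociated {f : G → ℂ} (hf : MemA μ f) {u k : G → ℝ}
    (hu : Continuous u) (hu0 : ∀ x, 0 ≤ u x) {S A M b : ℝ} (hS : 0 < S)
    (hfS : ∀ᵐ x ∂μ, u x ≠ 0 → ‖f x‖ ≤ S) (hA : 1 ≤ A) (hfA : normA μ f ≤ S * A)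
    (hk : Continuous k) (hk0 : ∀ x, 0 ≤ k x) (hksymm : ∀ x, k x⁻¹ = k x)
    (hk1 : ∫ x, k x ∂μ = 1) {N : ℕ} (hM : 0 < M)
    (huk : ∀ γ, ‖charInt μ u γ‖ ≤ M * ‖charInt μ k γ‖ ^ (2 * N + 2))
    {Λ : Finset (PontryaginDual G)}
    (hΛ : IsDissociated {γ : PontryaginDual G | 1 / 2 < ‖charInt μ k γ‖} Λ) (hcard : Λ.card ≤ N)
    (hb : ∀ γ ∈ Λ, b ≤ ‖fourier μ (fun x => f x * (u x : ℂ)) γ‖) :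
    Λ.card * b ≤ 16 * (M * S * (1 + Real.log A)) := by
  classical
  -- In all `2N + 2` factors of `k`. The exponent is even, for nonnegativity of the transform, and
  -- at least `|Λ|`, so `θ = 2^{-(2N+2)}` beats the `2^|Λ|` total weight of the words.
  set K : G → ℝ := (conv μ k)^[2 * N + 1] k with hK
  have hKc : Continuous K := continuous_iterate_conv μ hk hk _
  have hKre : ∀ γ, (charInt μ K γ).re = ‖charInt μ k γ‖ ^ (2 * N + 2) := by
    intro γ
    have h1 : charInt μ k γ = (((charInt μ k γ).re : ℝ) : ℂ) :=
      Complex.ext rfl (by rw [charInt_im_eq_zero μ hksymm]; rfl)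
    rw [hK, charInt_iterate_conv μ hk hk, ← pow_succ, h1, ← Complex.ofReal_pow, Complex.ofReal_re,
      Complex.norm_real, Real.norm_eq_abs, Even.pow_abs ⟨N + 1, by ring⟩]
  have h := sum_norm_integral_le μ (ι := Λ) (fun i => i.1) hf hu hu0 hS hfS hA hfA (K := K) hKc
    (iterate_conv_nonneg μ hk0 hk0 _) (by rw [hK, integral_iterate_conv μ hk hk hk1, hk1])
    (θ := (1 / 2) ^ (2 * N + 2)) (by
      rw [Fintype.card_coe]
      calc ((1 : ℝ) / 2) ^ (2 * N + 2) * 2 ^ Λ.card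
          ≤ (1 / 2) ^ (2 * N + 2) * 2 ^ (2 * N + 2) := by
            gcongr
            · norm_num
            · omega
        _ = 1 := by rw [← mul_pow]; norm_num) (by positivity)
    (fun m hm hm0 => by
      rw [hKre]
      gcongr
      by_contra! hcon
      let m' : PontryaginDual G → ℤ := fun γ => if hγ : γ ∈ Λ then m ⟨γ, hγ⟩ else 0
      have hm' : ∀ i : Λ, m' i.1 = m i := fun i => by simp [m']
      refine hΛ m' (fun γ => ?_) ?_ ?_
      · by_cases hγ : γ ∈ Λ
        · simp only [m', dif_pos hγ]
          exact Fintype.mem_piFinset.1 hm _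
        · simp [m', hγ, letters]
      · obtain ⟨i, hi⟩ := Function.ne_iff.1 hm0
        exact ⟨i.1, i.2, by rw [hm']; exact hi⟩
      · have e : ∏ γ ∈ Λ, γ ^ m' γ = wordChar (fun i : Λ => i.1) m := by
          rw [wordChar, ← Finset.prod_coe_sort]
          exact Finset.prod_congr rfl fun i _ => by rw [hm']
        rw [e]
        exact hcon) hM (fun γ => by rw [hKre]; exact huk γ)
  refine le_trans ?_ h
  calc (Λ.card : ℝ) * b = ∑ _i : Λ, b := by simp
    _ ≤ _ := Finset.sum_le_sum fun i _ => hb i.1 i.2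

end Main

end

end LocalChang

/-! ### Choice of parameters and conclusion. -/

theorem proposition6p4 (cR CR : ℝ) (hcR : 0 < cR) (hCR : 0 < CR) :
    ∃ C c : ℝ, 0 < C ∧ 0 < c ∧
      ∀ (G : Type*) [CommGroup G] [TopologicalSpace G] [IsTopologicalGroup G]
        [CompactSpace G] [T2Space G] [MeasurableSpace G] [BorelSpace G]
        (μ : Measure G) [IsHaarMeasure μ] [IsProbabilityMeasure μ]
        (Γ : Finset (PontryaginDual G)) (δ : ℝ) (f : G → ℂ) (ε η : ℝ),
        Γ.Nonempty → 0 < δ → δ ≤ 1 →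
        LocalChang.IsRegularBohr cR CR μ Γ δ →
        LocalChang.MemA μ f →
        LocalChang.supNormBohr μ (Γ : Set (PontryaginDual G)) δ f ≠ 0 →
        0 < ε → ε ≤ 1 → 0 < η → η ≤ 1 →
        ∀ A : ℝ,
          A = LocalChang.normA μ f /
            LocalChang.supNormBohr μ (Γ : Set (PontryaginDual G)) δ f →
        ∃ (Λ : Finset (PontryaginDual G)) (δ' : ℝ),
          0 < δ' ∧ δ' ≤ 1 ∧
          (Λ.card : ℝ) ≤ C * (ε⁻¹ * (1 + Real.log A)) ∧
          c * (ε ^ 2 * η * δ / ((Γ.card : ℝ) ^ 2 * (1 + Real.log A))) ≤ δ' ∧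
          {γ : PontryaginDual G |
              ε * LocalChang.supNormBohr μ (Γ : Set (PontryaginDual G)) δ f ≤
                ‖LocalChang.fourier
                  (LocalChang.bohrCutoff μ (Γ : Set (PontryaginDual G)) δ) f γ‖} ⊆
            {γ : PontryaginDual G |
              ∀ x ∈ LocalChang.bohrSet
                  ((Γ : Set (PontryaginDual G)) ∪ (Λ : Set (PontryaginDual G))) δ',
                ‖(1 : ℂ) - (γ x : ℂ)‖ ≤ η} := by
  -- In order: regularity loses at most `ε/2`; the perturbation `2κd` stays within `cR`; `N * δ'`
  -- stays below `η/16`.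
  set c₂ : ℝ := min (1 / (4 * CR)) (min (cR / 2) (1 / 4)) with hc₂
  have hc₂0 : 0 < c₂ := by positivity
  have hc₂1 : c₂ ≤ 1 / (4 * CR) := min_le_left _ _
  have hc₂2 : c₂ ≤ cR / 2 := (min_le_right _ _).trans (min_le_left _ _)
  have hc₂3 : c₂ ≤ 1 / 4 := (min_le_right _ _).trans (min_le_right _ _)
  -- 32 is the 16 of `sum_norm_integral_le` divided by the `1/2` of `ε/2`; 26112 = 2 · 51 · 256
  -- collects the kernel radius, the kernel spectrum and the bound for `n`.
  refine ⟨32, c₂ / 26112, by norm_num, by positivity, ?_⟩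
  intro G _ _ _ _ _ _ _ μ _ _ Γ δ f ε η hΓ hδ hδ1 hreg hf hS hε hε1 hη hη1 A hAdef
  set S := LocalChang.supNormBohr μ (Γ : Set (PontryaginDual G)) δ f with hSdef
  have hS0 : 0 < S := lt_of_le_of_ne ENNReal.toReal_nonneg (Ne.symm hS)
  have hSA : S ≤ LocalChang.normA μ f :=
    ENNReal.toReal_le_of_le_ofReal (tsum_nonneg fun _ => norm_nonneg _)
      (LocalChang.supNormBohr_le_normA μ hf)
  have hA : 1 ≤ A := by rw [hAdef, le_div_iff₀ hS0, one_mul]; exact hSA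
  have hfA : LocalChang.normA μ f ≤ S * A := by rw [hAdef, mul_div_cancel₀ _ hS0.ne']
  have hlog : 0 ≤ Real.log A := Real.log_nonneg hA
  set lA : ℝ := 1 + Real.log A with hlA
  have hlA1 : 1 ≤ lA := by linarith
  have hd : (1 : ℝ) ≤ Γ.card := by exact_mod_cast hΓ.card_pos
  set d : ℝ := (Γ.card : ℝ) with hddef
  have hd0 : 0 < d := by linarith
  set R : ℝ := 32 * (ε⁻¹ * lA) with hR
  have hεinv : 1 ≤ ε⁻¹ := (one_le_inv₀ hε).2 hε1
  have hR1 : 32 ≤ R := by rw [hR]; nlinarith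
  -- Fixed before the kernel, which depends on it. A size at most `R` is then strictly below `N`, as
  -- `exists_isDissociated_span` requires.
  set N : ℕ := ⌊R⌋₊ + 1 with hN
  have hNR : (N : ℝ) ≤ 2 * R := by
    rw [hN]; push_cast
    linarith [Nat.floor_le (by linarith : 0 ≤ R)]
  have hN1 : (1 : ℝ) ≤ N := by rw [hN]; push_cast; linarith [Nat.cast_nonneg (α := ℝ) ⌊R⌋₊]
  set n : ℕ := 2 * N + 2 with hn
  have hn0 : (0 : ℝ) < n := by rw [hn]; push_cast; linarith
  have hnR : (n : ℝ) ≤ 256 * (ε⁻¹ * lA) := by rw [hn]; push_cast; linarith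
  set κ : ℝ := c₂ * ε / d with hκ
  have hκ0 : 0 < κ := by positivity
  have hκd : κ * d = c₂ * ε := div_mul_cancel₀ _ hd0.ne'
  obtain ⟨k, hk, hk0, hksymm, hk1, hksupp, hkspec⟩ :=
    LocalChang.exists_kernel μ hΓ (r := κ * δ / (2 * n)) (by positivity) hη hη1
  obtain ⟨u, hu, hu0, hu1, husupp, huint, huk⟩ :=
    LocalChang.exists_smooth_cutoff μ hΓ (n := n) hδ hreg hκ0 (by nlinarith) hk hk0 hk1
      (fun x hx => by
        have h1 := hksupp x hx
        calc (n : ℝ) * LocalChang.bohrGauge hΓ x ≤ n * (2 * (κ * δ / (2 * n))) := by gcongr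
          _ = κ * δ := by field_simp) (by omega)
  set M := μ.real (LocalChang.bohrSet (Γ : Set (PontryaginDual G)) δ) with hMdef
  have hM : 0 < M := LocalChang.measureReal_bohrSet_pos μ hΓ hδ
  have hfS : ∀ᵐ x ∂μ, u x ≠ 0 → ‖f x‖ ≤ S := by
    filter_upwards [LocalChang.ae_norm_le_supNormBohr (Γ := Γ) (δ := δ) μ hf] with x hx hux
    exact hx (husupp x hux)
  have hτ : CR * (2 * κ * d) ≤ ε / 2 := by
    rw [le_div_iff₀ (by positivity)] at hc₂1
    calc CR * (2 * κ * d) = c₂ * (4 * CR) * (ε / 2) := by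
          rw [mul_assoc 2 κ d, hκd]; ring
      _ ≤ 1 * (ε / 2) := by gcongr
      _ = ε / 2 := one_mul _
  set Spec : Set (PontryaginDual G) := {γ | ε * S ≤
    ‖LocalChang.fourier (LocalChang.bohrCutoff μ (Γ : Set (PontryaginDual G)) δ) f γ‖} with hSpec
  have hlarge : ∀ γ ∈ Spec, ε / 2 * S * M ≤ ‖LocalChang.fourier μ (fun x => f x * (u x : ℂ)) γ‖ := by
    intro γ hγ
    have h1 := LocalChang.norm_fourier_bohrCutoff_le μ hΓ hδ hf hu hu1 husupp huint γ
    have h2 : M * (ε * S) ≤ _ := mul_le_mul_of_nonneg_left hγ hM.le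
    have h3 : S * (CR * (2 * κ * d) * M) ≤ S * (ε / 2 * M) := by gcongr
    have h4 := h2.trans h1
    linarith
  set T : Set (PontryaginDual G) := {γ | 1 / 2 < ‖LocalChang.charInt μ k γ‖} with hT
  obtain ⟨Λ, hΛN, hΛ⟩ := LocalChang.exists_isDissociated_span T Spec
    (by
      rw [hT, Set.mem_ofPred_eq, LocalChang.charInt_one, hk1]
      norm_num)
    (fun γ hγ => by
      rw [hT, Set.mem_ofPred_eq, LocalChang.norm_charInt_inv]
      exact hγ) N (fun Λ hΛS hΛd hΛN => by
      have h1 := LocalChang.card_mul_le_of_isDissociated μ hf hu hu0 hS0 hfS hA hfA hk hk0 hksymm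
        hk1 hM huk hΛd hΛN fun γ hγ => hlarge γ (hΛS hγ)
      have h2 : (Λ.card : ℝ) ≤ R := by
        have h3 : (Λ.card : ℝ) * ε * (M * S) ≤ 32 * lA * (M * S) := by linarith
        have h4 := le_of_mul_le_mul_right h3 (by positivity)
        rw [hR, ← div_eq_inv_mul, ← mul_div_assoc, le_div_iff₀ hε]
        exact h4
      rw [hN]
      exact Nat.lt_succ_of_le (Nat.le_floor h2))
  have hΛR : (Λ.card : ℝ) ≤ R :=
    (Nat.cast_le.2 (Nat.le_of_lt_succ hΛN)).trans (Nat.floor_le (by linarith))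
  set δ' : ℝ := c₂ / 26112 * (ε ^ 2 * η * δ / (d ^ 2 * lA)) with hδ'
  have hδ'0 : 0 < δ' := by positivity
  have hδ'1 : δ' ≤ κ * δ / (2 * n) * η / (51 * d) := by
    calc δ' = c₂ * ε * δ * η / (102 * d ^ 2 * (256 * (ε⁻¹ * lA))) := by
          rw [hδ']; field_simp; norm_num
      _ ≤ c₂ * ε * δ * η / (102 * d ^ 2 * n) := by gcongr
      _ = _ := by rw [hκ]; field_simp; norm_num
  have hδ'2 : 2 * Real.pi * (N * δ') ≤ η / 2 := by
    have h1 : δ' ≤ c₂ / 26112 * (ε ^ 2 * η * 1 / (1 ^ 2 * lA)) := by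
      rw [hδ']; gcongr
    have h2 : N * δ' ≤ η / 16 := by
      calc N * δ' ≤ (2 * R) * (c₂ / 26112 * (ε ^ 2 * η * 1 / (1 ^ 2 * lA))) := by gcongr
        _ = c₂ * 64 / 26112 * ε * η := by rw [hR]; field_simp; norm_num
        _ ≤ (1 / 4) * 64 / 26112 * 1 * η := by gcongr
        _ ≤ η / 16 := by linarith
    calc 2 * Real.pi * (N * δ') ≤ 2 * 4 * (η / 16) := by
          gcongr
          exact Real.pi_le_four
      _ = η / 2 := by ring
  refine ⟨Λ, δ', hδ'0, ?_, hΛR, le_rfl, fun γ hγ x hx => ?_⟩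
  · have h1 : δ' ≤ N * δ' := le_mul_of_one_le_left hδ'0.le hN1
    have h2 : 1 * (N * δ') ≤ 2 * Real.pi * (N * δ') := by
      gcongr
      linarith [Real.pi_gt_three]
    linarith
  · obtain ⟨m, hm, hmT⟩ := hΛ γ hγ
    have hxΓ : LocalChang.bohrGauge hΓ x ≤ κ * δ / (2 * n) * η / (51 * d) :=
      ((LocalChang.bohrGauge_le_iff hΓ).2 fun χ hχ => hx χ (Or.inl hχ)).trans hδ'1
    have h1 := hkspec _ hmT x hxΓ
    set w : PontryaginDual G := ∏ a ∈ Λ, a ^ m a with hw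
    have hwx : w x = ∏ a ∈ Λ, (a x) ^ m a := by
      let φ : PontryaginDual G →* Circle :=
        { toFun := fun χ => χ x, map_one' := rfl, map_mul' := fun _ _ => rfl }
      have : φ w = ∏ a ∈ Λ, φ a ^ m a := by rw [hw, map_prod]; simp only [map_zpow]
      exact this
    have h2 : ‖(1 : ℂ) - (w x : ℂ)‖ ≤ η / 2 := by
      refine (LocalChang.norm_one_sub_le_circleVal _).trans (le_trans ?_ hδ'2)
      rw [hwx]
      have h3 := LocalChang.circleVal_prod_zpow_le Λ (fun a => a x) m hm (t := δ')
        fun a ha => hx a (Or.inr ha)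
      have h4 : (Λ.card : ℝ) * δ' ≤ N * δ' := by gcongr
      gcongr
      exact h3.trans h4
    -- The factor `γ * w` lies in `T` and is handled by `Γ`; the word `w` is handled by `Λ`. Each
    -- costs `η/2`.
    have h5 : (1 : ℂ) - (γ x : ℂ)
        = (1 - ((γ * w) x : ℂ)) - (γ x : ℂ) * (1 - (w x : ℂ)) := by
      rw [LocalChang.mul_char_apply]; ring
    rw [h5]
    refine (norm_sub_le _ _).trans ?_
    rw [norm_mul, Circle.norm_coe, one_mul]
    linarith
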